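/- Let $\overline A$ be a finite set, let $A\subset\overline A$ and $\partial A=\overline A\setminus A$, and let $p$ be a nonnegative weight on the directed edges of $\overline A$ with at least one endpoint in $A$. Assume that $p$ is integrable on $A$: every positive eigenvalue of the matrix $[\,|p(u,v)|\,]_{u,v\in A}$ is strictly less than $1$. The weight $p(\omega)$ of a walk $\omega=[\omega_0,\dots,\omega_n]$ is $\prod_{j=1}^n p(\omega_{j-1},\omega_j)$ (so $1$ if $n=0$). For $B\subset A$ and $x,y\in B$, $\mathcal K_B(x,y)$ is the set of walks in $B$ from $x$ to $y$, and $G_B(x,y)=\sum_{\omega\in\mathcal K_B(x,y)}p(\omega)$. Fix $x\in A$. An elementary loop at $x$ is a nontrivial $l\in\mathcal K_A(x,x)$ that visits $x$ only at its two ends. Let $\tilde{\mathcal L}^k_x$ be the set of concatenations of $k$ elementary loops at $x$, with $\tilde{\mathcal L}^0_x=\{[x]\}$; so $\mathcal K_A(x,x)=\bigcup_{k\ge0}\tilde{\mathcal L}_x^k$. Let $(N^l_t)_{t\ge0}$, for $l\in\mathcal K_A(x,x)\setminus\{[x]\}$, be independent Poisson processes, where $N^l$ has rate $m'(l)=p(l)/n(l;x)$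 with $n(l;x)=\#\{1\le j\le n: l_j=x\}$ for $l=[l_0,\dots,l_n]$. The growing loop $l(t)$ is the concatenation of all the loops that appear up to time $t$, in the order in which they appear (and $l(t)=[x]$ if there are none). Then $l(t)$ is almost surely well defined for each $t\ge 0$, and is a random element of $\mathcal K_A(x,x)$. For every real $t>0$, its law $\mu_t$ is $$\mu_t(l)=\frac{1}{G_A(x,x)^t}\,\frac{\Gamma(k+t)}{k!\,\Gamma(t)}\,p(l),\qquad l\in\tilde{\mathcal L}_x^k,\quad k\ge0.$$ In particular, $\mu_1(l)=p(l)/G_A(x,x)$ for all $l\in\mathcal K_A(x,x)$. Moreover, $\mu_1$ is the law of the loops erased in chronological loop-erasure, in the following sense. Let $T\subset\overline A$, and consider the measure $p$ on the set $\mathcal K_A(x,T)$ of walks $\omega=[\omega_0,\dots,\omega_n]$ with $\omega_0=x$, $\omega_n\in T$ and $\omega_j\in A$ for $j<n$. Suppose that it is not the zero measure, and normalize it to a probability measure. (If $p$ comes from a Markov chain and $T=\partial A$, this is the law of the chain from $x$ stopped when it leaves $A$.) Then the loop $[\omega_0,\dots,\omega_{j_0}]$, $j_0=\max\{j:\omega_j=x\}$,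 that is erased at $x$ has law $\mu_1$. More generally, let $\eta=[\eta_0,\dots,\eta_m]$ be such that the loop-erasure $LE(\omega)$ equals $\eta$ with positive probability, and write $\omega=l^0\oplus[\eta_0,\eta_1]\oplus l^1\oplus\cdots\oplus[\eta_{m-1},\eta_m]\oplus l^m$, where $l^j$ is the loop erased at $\eta_j$. Put $A_j=A\setminus\{\eta_0,\dots,\eta_{j-1}\}$. Then, given $LE(\omega)=\eta$, the loops $l^j$ with $\eta_j\in A$ are independent, and $l^j$ has law $p(l)/G_{A_j}(\eta_j,\eta_j)$, $l\in\mathcal K_{A_j}(\eta_j,\eta_j)$; if $\eta_m\in\partial A$, then $l^m=[\eta_m]$ is trivial. -/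

import Mathlib

open MeasureTheory ProbabilityTheory
open scoped NNReal ENNReal

/-! ### Walks, weights and loops

`V` is the finite set of all vertices (the closure of `A`), and the boundary of `A` is its
complement in `V`. A walk `[ω₀, …, ωₙ]` is the nonempty list of its `n + 1` vertices. -/

/-- Walks are discrete objects: every set of lists is measurable. -/
instance walkMeasurableSpace {V : Type*} : MeasurableSpace (List V) := ⊤

/-- `p` is nonnegative on all directed edges with at least one endpoint in `A`. -/
def IsPositiveWeight {V : Type*} (A : Finset V) (p : V → V → ℝ) : Prop :=
  ∀ u v, u ∈ A ∨ v ∈ A → 0 ≤ p u v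

/-- The weight `p` is integrable on `A`: all positive eigenvalues of the matrix
`[|p(u,v)|]`, `u, v ∈ A`, are strictly less than one. -/
def IsIntegrableWeight {V : Type*} [DecidableEq V] (A : Finset V) (p : V → V → ℝ) : Prop :=
  ∀ r : ℝ, 0 < r →
    Module.End.HasEigenvalue (Matrix.toLin' (Matrix.of fun u v : A => |p u v|)) r → r < 1

/-- The weight of a walk: the product of the weights of its edges (one for a trivial walk). -/
def walkWeight {V : Type*} (p : V → V → ℝ) (ω : List V) : ℝ :=
  (List.zipWith p ω ω.tail).prod

/-- Concatenation of walks, for `ω₂` starting where `ω₁` ends. -/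
def walkConcat {V : Type*} (ω₁ ω₂ : List V) : List V :=
  ω₁ ++ ω₂.tail

/-- For `x ∈ A`: the walks from `x` to a point of `T`, all of whose vertices before the terminal
one are in `A`. The terminal vertex may be in `A` or in the boundary. -/
def walks {V : Type*} (A : Finset V) (x : V) (T : Set V) : Set (List V) :=
  {ω | ω.head? = some x ∧ (∀ v ∈ ω.dropLast, v ∈ A) ∧ ∃ y ∈ T, ω.getLast? = some y}

/-- For `x ∈ A`: the loops in `A` rooted at `x`, including the trivial loop `[x]`.
(For `x ∉ A` only the trivial loop remains.) -/
def loopsAt {V : Type*} (A : Finset V) (x : V) : Set (List V) :=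
  walks A x {x}

/-- The nontrivial loops in `A` rooted at `x`. -/
def nontrivialLoops {V : Type*} (A : Finset V) (x : V) : Set (List V) :=
  {l | l ∈ loopsAt A x ∧ l ≠ [x]}

/-- The elementary loops at `x`: nontrivial loops that visit `x` only at their initial and
terminal vertices. -/
def elementaryLoops {V : Type*} (A : Finset V) (x : V) : Set (List V) :=
  {l | l ∈ nontrivialLoops A x ∧ x ∉ l.tail.dropLast}

/-- The loops at `x` that are concatenations of `k` elementary loops (for `k = 0`, only the
trivial loop). -/
def loopsOfOrder {V : Type*} (A : Finset V) (x : V) : ℕ → Set (List V)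
  | 0 => {[x]}
  | k + 1 => {l | ∃ l₁ ∈ elementaryLoops A x, ∃ l₂ ∈ loopsOfOrder A x k, l = walkConcat l₁ l₂}

/-- The Green's function `G_A(x,y)`: the total weight of the walks from `x` to `y`. -/
noncomputable def green {V : Type*} (A : Finset V) (p : V → V → ℝ) (x y : V) : ℝ :=
  ∑' ω : walks A x {y}, walkWeight p ω

/-! ### Poisson processes and soups -/

/-- `N` is a Poisson process with rate `r` under `P`. -/
structure IsPoissonProcess {Ω : Type*} [MeasurableSpace Ω] (N : ℝ≥0 → Ω → ℕ) (r : ℝ≥0)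
    (P : Measure Ω) : Prop where
  measurable : ∀ t, Measurable (N t)
  start : ∀ᵐ ω ∂P, N 0 ω = 0
  paths : ∀ᵐ ω ∂P, Monotone (fun t => N t ω) ∧
    ∀ t, ContinuousWithinAt (fun s => N s ω) (Set.Ici t) t
  indep : HasIndepIncrements N P
  law : ∀ s t, s ≤ t → P.map (fun ω => N t ω - N s ω) = poissonMeasure (r * (t - s))

/-- `N` is a soup from the measure with point masses `μ i`: a family of independent Poisson
processes `N i`, with rates `μ i`. -/
structure IsSoup {ι Ω : Type*} [MeasurableSpace Ω] (N : ι → ℝ≥0 → Ω → ℕ) (μ : ι → ℝ≥0)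
    (P : Measure Ω) : Prop where
  poisson : ∀ i, IsPoissonProcess (N i) (μ i) P
  indep : iIndepFun (fun i ω t => N i t ω) P

/-- `h = [(s₁, i₁), …, (sⱼ, iⱼ)]`, with `s₁ < ⋯ < sⱼ ≤ t`, is the list of all the appearances up to
time `t` in the realization `n` of a soup, in the order in which they appear: `n i s` is the number
of appearances of `i` up to time `s`, for all `i` and all `s ≤ t`. -/
structure IsHistory {ι : Type*} (n : ι → ℝ≥0 → ℕ) (t : ℝ≥0) (h : List (ℝ≥0 × ι)) : Prop where
  increasing : (h.map Prod.fst).Pairwise (· < ·)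
  le_time : ∀ e ∈ h, e.1 ≤ t
  count : ∀ i, ∀ s ≤ t,
    open Classical in n i s = h.countP (fun e => decide (e.1 ≤ s ∧ e.2 = i))

/-! ### The growing loop -/

/-- The measure `m'` on the nontrivial loops `l` rooted at `x`: the weight of `l` divided by the
number of visits `#{1 ≤ j ≤ n : lⱼ = x}` of `l = [l₀, …, lₙ]` to `x`. -/
noncomputable def rootedLoopMass {V : Type*} [DecidableEq V] {A : Finset V} (p : V → V → ℝ) (x : V)
    (l : nontrivialLoops A x) : ℝ≥0 :=
  Real.toNNReal (walkWeight p l / (l : List V).tail.count x)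

/-- The concatenation of a list of loops rooted at `x` (the trivial loop for the empty list). -/
def concatLoops {V : Type*} (x : V) (ls : List (List V)) : List V :=
  ls.foldr walkConcat [x]

open Classical in
/-- The growing loop at `x` at time `t` of a soup `N` of loops rooted at `x`: the concatenation of
the loops that have appeared up to time `t`, in the order in which they appear. (On the null event
on which they cannot be listed in a finite strict order, it is set to `[x]`.) -/
noncomputable def growingLoop {V Ω : Type*} {A : Finset V} {x : V}
    (N : nontrivialLoops A x → ℝ≥0 → Ω → ℕ) (t : ℝ≥0) (ω : Ω) : List V :=
  if h : ∃ e, IsHistory (fun l s => N l s ω) t e then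
    concatLoops x (h.choose.map fun e => (e.2 : List V))
  else [x]

/-! ### Loop-erasure -/

/-- The measure on walks that gives each `ω ∈ walks A x T` its weight. For the transition
probabilities of a Markov chain and `T` the boundary of `A`, it is the law of the chain started
at `x ∈ A` and stopped when it leaves `A`. -/
noncomputable def walkMeasure {V : Type*} (A : Finset V) (p : V → V → ℝ) (x : V) (T : Set V) :
    Measure (List V) :=
  Measure.sum fun ω : walks A x T => ENNReal.ofReal (walkWeight p ω) • Measure.dirac (ω : List V)

/-- The first loop erased from a walk `ω`, at its initial vertex: `[ω₀, …, ω_j]` where `j` is the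
largest index with `ω_j = ω₀`. -/
def firstErasedLoop {V : Type*} [DecidableEq V] : List V → List V
  | [] => []
  | v :: r => v :: r.rdropWhile (fun u => u ≠ v)

/-- The part `[ω_{j+1}, …, ωₙ]` of a walk `ω` that comes after its last visit `j` to its initial
vertex. -/
def afterLastVisit {V : Type*} [DecidableEq V] : List V → List V
  | [] => []
  | v :: r => r.rtakeWhile (fun u => u ≠ v)

theorem afterLastVisit_length_lt {V : Type*} [DecidableEq V] (v : V) (r : List V) :
    (afterLastVisit (v :: r)).length < (v :: r).length := by
  have h := (List.rtakeWhile_suffix (fun u => decide (u ≠ v)) r).length_le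
  simp only [afterLastVisit, List.length_cons]
  omega

/-- Chronological loop-erasure. -/
def loopErasure {V : Type*} [DecidableEq V] : List V → List V
  | [] => []
  | v :: r => v :: loopErasure (afterLastVisit (v :: r))
  termination_by ω => ω.length
  decreasing_by exact afterLastVisit_length_lt v r

/-- The loops `l⁰, l¹, …, lᵐ` in the decomposition
`ω = l⁰ ⊕ [η₀, η₁] ⊕ l¹ ⊕ ⋯ ⊕ [ηₘ₋₁, ηₘ] ⊕ lᵐ` of a walk with loop-erasure `[η₀, …, ηₘ]`. -/
def erasedLoops {V : Type*} [DecidableEq V] : List V → List (List V)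
  | [] => []
  | v :: r => firstErasedLoop (v :: r) :: erasedLoops (afterLastVisit (v :: r))
  termination_by ω => ω.length
  decreasing_by exact afterLastVisit_length_lt v r

/-! ### Positive solutions of linear equations -/

/-! Growing loop. If `m'` has total mass `Λ`, the marks of the soup up to time `t`, in order of
appearance, form the list `σ = [l₁, …, lⱼ]` with probability `exp(-Λt) · t^j/j! · ∏ m'(lᵢ)`
(`soupMass`). A loop `l` with `k` returns to `x` splits into `j` nontrivial loops in exactly one way
for each composition of `k` into `j` parts. The weight `p` is multiplicative and `m'` divides by the
parts, so the lists with concatenation `l` contribute `p(l)` times the coefficient of `z^k` in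
`(-log(1-z))^j` (`tsum_concatLoops_length`). Summing against `t^j/j!` gives the coefficient of `z^k`
in `(1-z)^(-t)`, the Gamma quotient (`sum_logCoeff`). At `t = 1` this coefficient is one, so
normalization forces `exp Λ = G_A(x,x)` (`ofReal_exp_eq_loopMass`).

The law of the marks is found by placing them in the slots of finer and finer grids. This yields
lower bounds on probabilities; they add up to one, so they are equalities, and almost surely there
is a history (`measure_eq_of_le_of_tsum_eq_one`).

Loop-erasure. A walk from `x` is uniquely a loop at `x` followed by a path that never returns to
`x`, and the weights multiply (`walkSum_firstErasedLoop`). Hence the erased loop is independent of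
the rest, with law `p/G`. The rest is a walk in `A \ {x}`, and induction along `η` gives the joint
law (`walkSum_erasedLoops`).

All sums are taken in `ℝ≥0∞`; integrability enters only through finiteness (`tsum_walkMass_ne_top`),
which rests on a nonnegative solution of `h = b + M h`. -/

theorem exists_nonneg_solution {n : Type*} [Fintype n] [DecidableEq n] (M : Matrix n n ℝ)
    (hM : ∀ i j, 0 ≤ M i j)
    (hev : ∀ r : ℝ, 0 < r → Module.End.HasEigenvalue (Matrix.toLin' M) r → r < 1)
    (b : n → ℝ) (hb : ∀ i, 0 < b i) :
    ∃ h : n → ℝ, (∀ i, 0 ≤ h i) ∧ ∀ i, h i = b i + ∑ j, M i j * h j := by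
  -- A kernel vector would be an eigenvector of `M` with eigenvalue `1/t ≥ 1`.
  have hdet : ∀ t : unitInterval, (1 - (t : ℝ) • M).det ≠ 0 := by
    intro t h0
    obtain ⟨v, hv, hv0⟩ := Matrix.exists_mulVec_eq_zero_iff.2 h0
    rw [Matrix.sub_mulVec, Matrix.one_mulVec, Matrix.smul_mulVec, sub_eq_zero] at hv0
    have ht : (t : ℝ) ≠ 0 := by
      intro ht
      rw [ht, zero_smul] at hv0
      exact hv hv0
    have htpos : 0 < (t : ℝ) := lt_of_le_of_ne t.2.1 (Ne.symm ht)
    have := hev (t : ℝ)⁻¹ (inv_pos.2 htpos)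
      (Module.End.hasEigenvalue_of_hasEigenvector (x := v)
        ⟨Module.End.mem_eigenspace_iff.2 (by
          rw [Matrix.toLin'_apply]
          nth_rewrite 2 [hv0]
          rw [smul_smul, inv_mul_cancel₀ ht, one_smul]), hv⟩)
    exact absurd ((one_le_inv₀ htpos).2 t.2.2) (not_le.2 this)
  let h : unitInterval → n → ℝ := fun t =>
    ((1 - (t : ℝ) • M).det)⁻¹ • ((1 - (t : ℝ) • M).adjugate.mulVec b)
  have hcont : Continuous h := by
    have hc : Continuous fun t : unitInterval => 1 - (t : ℝ) • M := by fun_prop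
    exact (hc.matrix_det.inv₀ hdet).smul (hc.matrix_adjugate.matrix_mulVec continuous_const)
  have heq : ∀ t i, h t i = b i + t * ∑ j, M i j * h t j := by
    intro t i
    have h1 : (1 - (t : ℝ) • M).mulVec (h t) = b := by
      simp only [h]
      rw [Matrix.mulVec_smul, Matrix.mulVec_mulVec, Matrix.mul_adjugate, Matrix.smul_mulVec,
        Matrix.one_mulVec, smul_smul, inv_mul_cancel₀ (hdet t), one_smul]
    rw [Matrix.sub_mulVec, Matrix.one_mulVec, Matrix.smul_mulVec] at h1
    have h2 := congrFun h1 i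
    simp only [Pi.sub_apply, Pi.smul_apply, smul_eq_mul, Matrix.mulVec, dotProduct] at h2
    linarith
  have hpos : ∀ t, (∀ i, 0 ≤ h t i) → ∀ i, 0 < h t i := by
    intro t ht i
    rw [heq]
    have : 0 ≤ (t : ℝ) * ∑ j, M i j * h t j :=
      mul_nonneg t.2.1 (Finset.sum_nonneg fun j _ => mul_nonneg (hM i j) (ht j))
    linarith [hb i]
  -- Connectedness of `[0,1]` carries nonnegativity from `t = 0`, where `h = b`, to `t = 1`. The set
  -- is open because a nonnegative solution dominates `b`, hence is strictly positive.
  have hclopen : IsClopen {t | ∀ i, 0 ≤ h t i} := by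
    constructor
    · simp only [Set.ofPred_forall]
      exact isClosed_iInter fun i =>
        isClosed_le continuous_const ((continuous_apply i).comp hcont)
    · have : {t | ∀ i, 0 ≤ h t i} = {t | ∀ i, 0 < h t i} :=
        Set.ext fun t => ⟨hpos t, fun h i => (h i).le⟩
      rw [this]
      simp only [Set.ofPred_forall]
      exact isOpen_iInter_of_finite fun i =>
        isOpen_lt continuous_const ((continuous_apply i).comp hcont)
  have huniv := hclopen.eq_univ ⟨0, fun i => by
    rw [heq]
    simpa using (hb i).le⟩
  refine ⟨h 1, Set.eq_univ_iff_forall.1 huniv 1, fun i => ?_⟩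
  simpa using heq 1 i

/-! ### Sums over lists -/

theorem ENNReal.tsum_list {α : Type*} (f : List α → ℝ≥0∞) :
    ∑' l, f l = f [] + ∑' a, ∑' l, f (a :: l) := by
  have hinj : Function.Injective fun q : α × List α => q.1 :: q.2 := by
    rintro ⟨a, l⟩ ⟨b, m⟩ h
    simpa using h
  rw [ENNReal.tsum_eq_add_tsum_ite [], ← ENNReal.tsum_prod (f := fun a l => f (a :: l)),
    ← hinj.tsum_eq]
  · simp
  · intro l hl
    cases l with
    | nil => simp at hl
    | cons a l => exact ⟨(a, l), rfl⟩

theorem ENNReal.tsum_list_length {α : Type*} (f : List α → ℝ≥0∞) :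
    ∑' l, f l = ∑' j : ℕ, ∑' l : List α, if l.length = j then f l else 0 := by
  rw [ENNReal.tsum_comm]
  refine tsum_congr fun l => ?_
  rw [tsum_eq_single l.length]
  · simp
  · intro j hj
    simp [hj.symm]

theorem ENNReal.tsum_list_length_prod {α : Type*} (m : α → ℝ≥0∞) (j : ℕ) :
    (∑' l : List α, if l.length = j then (l.map m).prod else 0) = (∑' a, m a) ^ j := by
  induction j with
  | zero =>
    rw [tsum_eq_single []]
    · simp
    · intro l hl
      simp [List.length_eq_zero_iff, hl]
  | succ j ih =>
    rw [ENNReal.tsum_list, pow_succ', ← ENNReal.tsum_mul_right]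
    simp only [List.length_nil, Nat.right_eq_add, Nat.add_eq_zero_iff, one_ne_zero, and_false,
      if_false, zero_add, List.length_cons, Nat.add_right_cancel_iff, List.map_cons, List.prod_cons]
    refine tsum_congr fun a => ?_
    rw [← ih, ← ENNReal.tsum_mul_left]
    exact tsum_congr fun l => by split_ifs <;> simp

/-! ### The product of the weights of the edges, as an extended nonnegative real -/

/-- The weight of a walk as an extended nonnegative real. -/
noncomputable def walkMass {V : Type*} (p : V → V → ℝ) : List V → ℝ≥0∞
  | [] => 1
  | [_] => 1
  | u :: v :: l => ENNReal.ofReal (p u v) * walkMass p (v :: l)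

theorem walkMass_append {V : Type*} (p : V → V → ℝ) (l : List V) (x : V) (r : List V) :
    walkMass p (l ++ x :: r) = walkMass p (l ++ [x]) * walkMass p (x :: r) := by
  induction l with
  | nil => simp [walkMass]
  | cons u l ih =>
    cases l with
    | nil => simp [walkMass]
    | cons v l =>
      simp only [List.cons_append, walkMass] at ih ⊢
      rw [ih, mul_assoc]

/-- Only the initial vertex of each edge has to be in `A`, so the walk may end on the boundary. -/
theorem walkMass_eq_ofReal {V : Type*} {A : Finset V} {p : V → V → ℝ} (hpos : IsPositiveWeight A p)
    (l : List V) (hl : ∀ v ∈ l.dropLast, v ∈ A) :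
    0 ≤ walkWeight p l ∧ walkMass p l = ENNReal.ofReal (walkWeight p l) := by
  induction l with
  | nil => simp [walkMass, walkWeight]
  | cons u l ih =>
    cases l with
    | nil => simp [walkMass, walkWeight]
    | cons v l =>
      simp only [List.dropLast_cons_cons, List.mem_cons, forall_eq_or_imp] at hl
      obtain ⟨h0, h1⟩ := ih hl.2
      have huv := hpos u v (Or.inl hl.1)
      have : walkWeight p (u :: v :: l) = p u v * walkWeight p (v :: l) := by
        simp [walkWeight]
      rw [this, walkMass, h1, ENNReal.ofReal_mul huv]
      exact ⟨mul_nonneg huv h0, rfl⟩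

theorem IsPositiveWeight.mono {V : Type*} {A B : Finset V} {p : V → V → ℝ}
    (hpos : IsPositiveWeight A p) (h : B ⊆ A) : IsPositiveWeight B p :=
  fun u v huv => hpos u v (huv.imp (@h u) (@h v))

-- One-step analysis: the total weight `h` of the walks from a vertex formally solves `h = b + M h`,
-- where `b` counts the trivial walk and the direct exits from `A`. By induction on the length, any
-- nonnegative solution dominates the truncated sums.
open Classical in
theorem tsum_walkMass_ne_top {V : Type*} [Fintype V] [DecidableEq V] {A : Finset V}
    {p : V → V → ℝ} (hpos : IsPositiveWeight A p) (hint : IsIntegrableWeight A p) {x : V}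
    (hx : x ∈ A) :
    (∑' l : List V, if ∀ v ∈ (x :: l).dropLast, v ∈ A then walkMass p (x :: l) else 0) ≠ ∞ := by
  obtain ⟨h, h0, hh⟩ := exists_nonneg_solution (Matrix.of fun u v : A => |p u v|)
    (fun u v => abs_nonneg _) hint (fun u => 1 + ∑ v ∈ Aᶜ, p u v) (fun u => by
      have := Finset.sum_nonneg (s := Aᶜ) fun v _ => hpos u v (Or.inl u.2)
      linarith)
  let U : ℕ → V → ℝ≥0∞ := fun n x => ∑' l : List V,
    if l.length ≤ n then if ∀ v ∈ (x :: l).dropLast, v ∈ A then walkMass p (x :: l) else 0 else 0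
  have hU : ∀ n, ∀ x : A, U n x ≤ ENNReal.ofReal (h x) := by
    have hone : ∀ x : A, 1 ≤ h x := fun x => by
      rw [hh]
      have h1 := Finset.sum_nonneg (s := Aᶜ) fun v _ => hpos x v (Or.inl x.2)
      have h2 : 0 ≤ ∑ j, Matrix.of (fun u v : A => |p u v|) x j * h j :=
        Finset.sum_nonneg fun v _ => mul_nonneg (abs_nonneg _) (h0 v)
      linarith
    intro n
    induction n with
    | zero =>
      intro x
      simp only [U]
      rw [tsum_eq_single []]
      · simpa [walkMass] using hone x
      · intro l hl
        simp [List.length_eq_zero_iff, hl]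
    | succ n ih =>
      intro x
      have hcons : U (n + 1) x = 1 + ∑ y, ENNReal.ofReal (p x y) *
          ∑' l : List V, if l.length ≤ n then
            if ∀ v ∈ (y :: l).dropLast, v ∈ A then walkMass p (y :: l) else 0 else 0 := by
        simp only [U]
        rw [ENNReal.tsum_list, tsum_fintype]
        congr 1
        · simp [walkMass]
        · refine Finset.sum_congr rfl fun y _ => ?_
          rw [← ENNReal.tsum_mul_left]
          refine tsum_congr fun l => ?_
          simp only [List.length_cons, Nat.add_le_add_iff_right, List.dropLast_cons_cons,
            List.mem_cons, forall_eq_or_imp, x.2, true_and, walkMass]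
          split_ifs <;> simp
      rw [hcons, ← Finset.sum_add_sum_compl A]
      have hA : ∑ y ∈ A, ENNReal.ofReal (p x y) * U n y ≤
          ENNReal.ofReal (∑ y : A, |p x y| * h y) := by
        rw [ENNReal.ofReal_sum_of_nonneg fun y _ => mul_nonneg (abs_nonneg _) (h0 y),
          ← Finset.sum_coe_sort A]
        refine Finset.sum_le_sum fun y _ => ?_
        rw [ENNReal.ofReal_mul (abs_nonneg _), abs_of_nonneg (hpos x y (Or.inl x.2))]
        gcongr
        exact ih y
      have hB : ∑ y ∈ Aᶜ, ENNReal.ofReal (p x y) * U n y ≤ ENNReal.ofReal (∑ y ∈ Aᶜ, p x y) := by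
        rw [ENNReal.ofReal_sum_of_nonneg fun y _ => hpos x y (Or.inl x.2)]
        refine Finset.sum_le_sum fun y hy => ?_
        -- From a boundary vertex only the trivial walk is admitted.
        have : U n y = 1 := by
          simp only [U]
          rw [tsum_eq_single []]
          · simp [walkMass]
          · intro l hl
            obtain ⟨z, l, rfl⟩ := List.exists_cons_of_ne_nil hl
            simp [Finset.mem_compl.1 hy]
        rw [this, mul_one]
      have h1 := Finset.sum_nonneg (s := Aᶜ) fun v _ => hpos x v (Or.inl x.2)
      have h2 : 0 ≤ ∑ y : A, |p x y| * h y :=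
        Finset.sum_nonneg fun v _ => mul_nonneg (abs_nonneg _) (h0 v)
      rw [hh x]
      simp only [Matrix.of_apply]
      rw [ENNReal.ofReal_add (by linarith) h2, ENNReal.ofReal_add zero_le_one h1,
        ENNReal.ofReal_one, add_assoc]
      exact add_le_add le_rfl ((add_comm _ _).trans_le (add_le_add hB hA))
  refine ne_top_of_le_ne_top (b := ENNReal.ofReal (h ⟨x, hx⟩)) ENNReal.ofReal_ne_top ?_
  rw [ENNReal.tsum_eq_iSup_sum]
  refine iSup_le fun s => le_trans ?_ (hU (s.sup List.length) ⟨x, hx⟩)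
  refine le_trans (Finset.sum_le_sum fun l hl => ?_) (ENNReal.sum_le_tsum s)
  rw [if_pos (Finset.le_sup (f := List.length) hl)]

/-! ### Histories -/

section History

variable {ι : Type*} {n : ι → ℝ≥0 → ℕ} {t s : ℝ≥0} {h h' : List (ℝ≥0 × ι)}

/-- The entries are the jumps of the counting paths, so the path determines the set of entries, and
strict ordering then determines the list. The condition `0 < n i s` covers `s = 0`, which has no
earlier time. -/
theorem IsHistory.mem_iff (H : IsHistory n t h) (s : ℝ≥0) (i : ι) :
    (s, i) ∈ h ↔ s ≤ t ∧ 0 < n i s ∧ ∀ s' < s, n i s' < n i s := by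
  classical
  constructor
  · intro hs
    have hst : s ≤ t := H.le_time _ hs
    refine ⟨hst, ?_, fun s' hs' => ?_⟩
    · rw [H.count i s hst, List.countP_pos_iff]
      exact ⟨_, hs, by simp⟩
    · rw [H.count i s hst, H.count i s' (hs'.le.trans hst)]
      obtain ⟨h₁, h₂, rfl⟩ := List.append_of_mem hs
      have hmono : ∀ l : List (ℝ≥0 × ι), l.countP (fun e => decide (e.1 ≤ s' ∧ e.2 = i)) ≤
          l.countP (fun e => decide (e.1 ≤ s ∧ e.2 = i)) := fun l =>
        List.countP_mono_left fun e _ he => by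
          simp only [decide_eq_true_eq] at he ⊢
          exact ⟨he.1.trans hs'.le, he.2⟩
      have h1 := hmono h₁
      have h2 := hmono h₂
      simp only [List.countP_append, List.countP_cons]
      simp only [le_refl, and_self, decide_true, if_true, not_le.2 hs', false_and, decide_false,
        Bool.false_eq_true, if_false]
      omega
  · rintro ⟨hst, hpos, hlt⟩
    by_contra hmem
    rw [H.count i s hst, List.countP_pos_iff] at hpos
    obtain ⟨e₀, he₀, he₀'⟩ := hpos
    let S := (h.toFinset.filter fun e => e.1 ≤ s ∧ e.2 = i)
    have hS : S.Nonempty := ⟨e₀, by simpa [S, he₀] using he₀'⟩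
    obtain ⟨e, he, hmax⟩ := S.exists_max_image Prod.fst hS
    simp only [S, Finset.mem_filter, List.mem_toFinset] at he hmax
    -- The last entry with mark `i` up to time `s` comes earlier than `s`, so the count cannot have
    -- grown in between.
    have hes : e.1 < s := lt_of_le_of_ne he.2.1 fun hes => hmem (by
      rw [← hes, ← he.2.2]
      exact he.1)
    refine absurd (hlt e.1 hes) (not_lt.2 ?_)
    rw [H.count i s hst, H.count i e.1 (hes.le.trans hst)]
    refine List.countP_mono_left fun e' he' h2 => ?_
    simp only [decide_eq_true_eq] at h2 ⊢
    exact ⟨hmax e' ⟨he', h2⟩, h2.2⟩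

theorem IsHistory.unique (H : IsHistory n t h) (H' : IsHistory n t h') : h = h' := by
  have hp : ∀ {l}, IsHistory n t l → l.Pairwise (fun a b => a.1 < b.1) := fun K =>
    List.pairwise_map.1 K.increasing
  have hnd : ∀ {l}, IsHistory n t l → l.Nodup := fun K =>
    (hp K).imp fun hab heq => by simp [heq] at hab
  have hperm : h.Perm h' := (List.perm_ext_iff_of_nodup (hnd H) (hnd H')).2 fun e => by
    rw [← Prod.mk.eta (p := e), H.mem_iff, H'.mem_iff]
  exact hperm.eq_of_pairwise (fun a b _ _ h1 h2 => absurd h1 (not_lt.2 h2.le)) (hp H) (hp H')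

theorem isHistory_nil (h0 : ∀ i, n i 0 = 0) : IsHistory n 0 [] where
  increasing := by simp
  le_time := by simp
  count i s hs := by
    rw [nonpos_iff_eq_zero.1 hs, h0]
    simp

theorem IsHistory.extend (H : IsHistory n s h) (hmono : ∀ i, Monotone (n i)) (hst : s ≤ t)
    (hinc : ∀ i, n i t = n i s) : IsHistory n t h where
  increasing := H.increasing
  le_time e he := (H.le_time e he).trans hst
  count i u hu := by
    obtain hus | hus := le_total u s
    · exact H.count i u hus
    · have : n i u = n i s :=
        le_antisymm ((hmono i hu).trans_eq (hinc i)) (hmono i hus)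
      rw [this, H.count i s le_rfl]
      refine List.countP_congr fun e he => ?_
      simp [H.le_time e he, (H.le_time e he).trans hus]

open Classical in
theorem IsHistory.extend_one (H : IsHistory n s h) (hmono : ∀ i, Monotone (n i))
    (hcont : ∀ i t, ContinuousWithinAt (n i) (Set.Ici t) t) (hst : s ≤ t) (a : ι)
    (hinc : ∀ i, n i t = n i s + if i = a then 1 else 0) :
    ∃ τ, IsHistory n t (h ++ [(τ, a)]) := by
  have ha : n a t = n a s + 1 := by simpa using hinc a
  let S := {u | n a s < n a u}
  have htS : t ∈ S := by simp [S, ha]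
  have hmin : ∀ u ∈ S, sInf S ≤ u := fun u hu => csInf_le (OrderBot.bddBelow S) hu
  -- The new entry is placed at the first time at which the count of `a` exceeds its value at `s`.
  -- The infimum is attained since a right-continuous integer path is constant just to the right of
  -- each time.
  have hτS : sInf S ∈ S := by
    have h1 := hcont a (sInf S)
    rw [ContinuousWithinAt, nhds_discrete, Filter.tendsto_pure,
      Filter.Eventually, mem_nhdsWithin] at h1
    obtain ⟨U, hU, hτU, hsub⟩ := h1
    obtain ⟨u, huU, huS⟩ := mem_closure_iff.1
      (csInf_mem_closure ⟨t, htS⟩ (OrderBot.bddBelow S)) U hU hτU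
    have h2 : n a u = n a (sInf S) := hsub ⟨huU, hmin u huS⟩
    change n a s < n a (sInf S)
    rw [← h2]
    exact huS
  have hsτ : s < sInf S := lt_of_not_ge fun hle => absurd hτS (not_lt.2 (hmono a hle))
  have hτt : sInf S ≤ t := hmin t htS
  refine ⟨sInf S, ?_, ?_, ?_⟩
  · rw [List.map_append, List.pairwise_append]
    refine ⟨H.increasing, by simp, fun u hu v hv => ?_⟩
    simp only [List.map_cons, List.map_nil, List.mem_singleton] at hv
    obtain ⟨e, he, rfl⟩ := List.mem_map.1 hu
    rw [hv]
    exact (H.le_time e he).trans_lt hsτ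
  · intro e he
    rw [List.mem_append, List.mem_singleton] at he
    obtain he | rfl := he
    · exact (H.le_time e he).trans hst
    · exact hτt
  · intro i u hu
    rw [List.countP_append, List.countP_singleton]
    obtain hus | hus := le_total u s
    · rw [H.count i u hus]
      simp [not_le.2 (hus.trans_lt hsτ)]
    · have hcount : h.countP (fun e => decide (e.1 ≤ u ∧ e.2 = i)) = n i s := by
        rw [H.count i s le_rfl]
        refine List.countP_congr fun e he => ?_
        simp [H.le_time e he, (H.le_time e he).trans hus]
      rw [hcount]
      have h1 := hmono i hus
      have h2 := hmono i hu
      rw [hinc] at h2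
      by_cases hi : i = a
      · subst hi
        by_cases hτu : sInf S ≤ u
        · have h3 : n i s < n i u := lt_of_lt_of_le hτS (hmono i hτu)
          simp [hτu] at h2 ⊢
          omega
        · have h3 : ¬ n i s < n i u := fun h3 => hτu (hmin u h3)
          simp [hτu]
          omega
      · simp only [hi, if_false, add_zero] at h2
        simp [Ne.symm hi]
        omega

-- When each slot holds at most one appearance, the order of the slots is the order of appearance.
open Classical in
theorem exists_isHistory_of_grid (h0 : ∀ i, n i 0 = 0) (hmono : ∀ i, Monotone (n i))
    (hcont : ∀ i t, ContinuousWithinAt (n i) (Set.Ici t) t) (δ : ℝ≥0) (c : List (Option ι))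
    (hc : ∀ i (k : Fin c.length),
      n i ((k + 1 : ℕ) * δ) - n i ((k : ℕ) * δ) = if c.get k = some i then 1 else 0) :
    ∃ h, IsHistory n (c.length * δ) h ∧ h.map Prod.snd = c.reduceOption := by
  induction c using List.reverseRecOn with
  | nil => exact ⟨[], by simpa using isHistory_nil h0, rfl⟩
  | append_singleton c o ih =>
    obtain ⟨h, H, hh⟩ := ih fun i k => by
      have := hc i ⟨k, by simp⟩
      simpa [List.getElem_append_left k.2] using this
    have hle : (c.length : ℝ≥0) * δ ≤ ((c.length + 1 : ℕ) : ℝ≥0) * δ := by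
      gcongr
      omega
    -- Subtraction in `ℕ` is truncated; monotonicity turns the increment into a sum.
    have hlast : ∀ i, n i ((c.length + 1 : ℕ) * δ) =
        n i (c.length * δ) + if o = some i then 1 else 0 := fun i => by
      have h1 := hc i ⟨c.length, by simp⟩
      have h2 := hmono i hle
      simp only [List.get_eq_getElem, List.getElem_concat_length] at h1
      omega
    rw [List.length_append, List.length_singleton]
    cases o with
    | none =>
      refine ⟨h, H.extend hmono hle fun i => by simpa using hlast i, ?_⟩
      rw [hh, List.reduceOption_append]
      simp
    | some a =>
      obtain ⟨τ, hτ⟩ := H.extend_one hmono hcont hle a fun i => by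
        rw [hlast]
        simp [eq_comm]
      refine ⟨_, hτ, ?_⟩
      rw [List.map_append, hh, List.reduceOption_append]
      simp

end History

/-! ### Arrangements of a list of marks in time slots -/

section Slots

variable {ι : Type*}

open Classical in
/-- The arrangements of a list of marks, in order, in `n` slots with at most one mark each. -/
noncomputable def slots : ℕ → List ι → Finset (List (Option ι))
  | 0, [] => {[]}
  | 0, _ :: _ => ∅
  | n + 1, [] => (slots n []).image (List.cons none)
  | n + 1, a :: σ => (slots n (a :: σ)).image (List.cons none) ∪
      (slots n σ).image (List.cons (some a))

theorem length_of_mem_slots {n : ℕ} {σ : List ι} {c : List (Option ι)} (hc : c ∈ slots n σ) :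
    c.length = n ∧ c.reduceOption = σ := by
  classical
  induction n generalizing σ c with
  | zero =>
    cases σ <;> simp_all [slots]
  | succ n ih =>
    cases σ with
    | nil =>
      simp only [slots, Finset.mem_image] at hc
      obtain ⟨c, hc, rfl⟩ := hc
      simp [ih hc]
    | cons a σ =>
      simp only [slots, Finset.mem_union, Finset.mem_image] at hc
      obtain ⟨c, hc, rfl⟩ | ⟨c, hc, rfl⟩ := hc <;> simp [ih hc]

/-- Pascal's rule: the first slot is empty or holds the first mark. -/
theorem card_slots (n : ℕ) (σ : List ι) : (slots n σ).card = n.choose σ.length := by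
  classical
  induction n generalizing σ with
  | zero => cases σ <;> simp [slots]
  | succ n ih =>
    cases σ with
    | nil =>
      rw [slots, Finset.card_image_of_injective _ List.cons_injective, ih]
      simp
    | cons a σ =>
      rw [slots, Finset.card_union_of_disjoint, Finset.card_image_of_injective _ List.cons_injective,
        Finset.card_image_of_injective _ List.cons_injective, ih, ih, List.length_cons,
        Nat.choose_succ_succ, add_comm]
      rw [Finset.disjoint_left]
      intro c h1 h2
      simp only [Finset.mem_image] at h1 h2
      obtain ⟨c₁, -, rfl⟩ := h1
      obtain ⟨c₂, -, h⟩ := h2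
      simp at h

end Slots

/-! ### The law of the list of marks of a soup -/

section Soup

variable {ι Ω : Type*} {mΩ : MeasurableSpace Ω} {P : Measure Ω}
  {N : ι → ℝ≥0 → Ω → ℕ} {μ : ι → ℝ≥0} {Λ : ℝ≥0}

open Classical in
/-- The event that, in the grid of mesh `δ`, the `k`-th slot contains the mark `c k`, if there is
one, and nothing else. -/
def gridEvent (N : ι → ℝ≥0 → Ω → ℕ) (δ : ℝ≥0) (c : List (Option ι)) : Set Ω :=
  ⋂ i, {ω | ∀ k : Fin c.length,
    N i ((k + 1 : ℕ) * δ) ω - N i ((k : ℕ) * δ) ω = if c.get k = some i then 1 else 0}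

theorem measurableSet_gridEvent [Countable ι] (hN : IsSoup N μ P) (δ : ℝ≥0) (c : List (Option ι)) :
    MeasurableSet (gridEvent N δ c) := by
  refine MeasurableSet.iInter fun i => ?_
  simp only [Set.ofPred_forall]
  exact MeasurableSet.iInter fun k =>
    (((hN.poisson i).measurable _).sub ((hN.poisson i).measurable _)) (measurableSet_singleton _)

theorem disjoint_gridEvent (δ : ℝ≥0) {c c' : List (Option ι)} (hl : c.length = c'.length)
    (hne : c ≠ c') : Disjoint (gridEvent N δ c) (gridEvent N δ c') := by
  classical
  rw [Set.disjoint_left]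
  intro ω h1 h2
  refine hne (List.ext_getElem hl fun k hk hk' => Option.ext fun i => ?_)
  have h3 := Set.mem_iInter.1 h1 i ⟨k, hk⟩
  have h4 := Set.mem_iInter.1 h2 i ⟨k, hk'⟩
  simp only [List.get_eq_getElem] at h3 h4
  rw [h3] at h4
  split_ifs at h4 <;> simp_all

open Classical in
theorem measure_gridEvent_coordinate (hN : IsSoup N μ P) (δ : ℝ≥0) (c : List (Option ι)) (i : ι) :
    P {ω | ∀ k : Fin c.length,
      N i ((k + 1 : ℕ) * δ) ω - N i ((k : ℕ) * δ) ω = if c.get k = some i then 1 else 0} =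
    ∏ k : Fin c.length, (ENNReal.ofReal (Real.exp (-(μ i * δ))) *
      if c.get k = some i then (μ i * δ : ℝ≥0∞) else 1) := by
  have hind := (hN.poisson i).indep c.length (fun k => (k : ℕ) * δ) fun k l hkl => by
    simp only
    gcongr
    exact_mod_cast hkl
  have h := hind.measure_inter_preimage_eq_mul Finset.univ
    (sets := fun k => {if c.get k = some i then 1 else 0}) fun k _ => measurableSet_singleton _
  simp only [Finset.mem_univ, Set.iInter_true] at h
  convert h using 2 with k
  · ext ω
    simp
  · symm
    have hle : ((k.castSucc : ℕ) : ℝ≥0) * δ ≤ ((k.succ : ℕ) : ℝ≥0) * δ := by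
      gcongr
      simp
    have hlaw := (hN.poisson i).law _ _ hle
    have hsub : ((k.succ : ℕ) : ℝ≥0) * δ - ((k.castSucc : ℕ) : ℝ≥0) * δ = δ := by
      rw [← tsub_mul]
      simp
    rw [hsub] at hlaw
    have hm : Measurable fun ω => N i ((k.succ : ℕ) * δ) ω - N i ((k.castSucc : ℕ) * δ) ω :=
      ((hN.poisson i).measurable _).sub ((hN.poisson i).measurable _)
    rw [← Measure.map_apply hm (measurableSet_singleton _), hlaw, poissonMeasure_singleton]
    split_ifs
    · simp only [NNReal.coe_mul, pow_one, Nat.factorial_one, Nat.cast_one, div_one]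
      rw [ENNReal.ofReal_mul (Real.exp_pos _).le, ← NNReal.coe_mul, ENNReal.ofReal_coe_nnreal,
        ENNReal.coe_mul]
    · simp

-- For finitely many marks the probability is an exact product, with the exponent `∑ μ i` over these
-- marks in place of `Λ`. Enlarging this exponent to `Λ` gives a bound uniform in the finite set,
-- which passes to the countable intersection by continuity from above.
open Classical in
theorem le_measure_gridEvent [IsProbabilityMeasure P] [Countable ι] (hN : IsSoup N μ P)
    (hΛ : ∑' i, (μ i : ℝ≥0∞) = Λ)
    (δ : ℝ≥0) (c : List (Option ι)) :
    ENNReal.ofReal (Real.exp (-(Λ * (c.length * δ)))) *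
      ((δ : ℝ≥0∞) ^ c.reduceOption.length * (c.reduceOption.map fun i => (μ i : ℝ≥0∞)).prod) ≤
    P (gridEvent N δ c) := by
  have hmeas : ∀ i, MeasurableSet {f : ℝ≥0 → ℕ | ∀ k : Fin c.length,
      f ((k + 1 : ℕ) * δ) - f ((k : ℕ) * δ) = if c.get k = some i then 1 else 0} := by
    intro i
    simp only [Set.ofPred_forall]
    exact MeasurableSet.iInter fun k =>
      ((measurable_pi_apply ((k + 1 : ℕ) * δ)).sub (measurable_pi_apply ((k : ℕ) * δ)))
        (measurableSet_singleton _)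
  have hS : ∀ S : Finset ι, c.reduceOption.toFinset ⊆ S →
      ENNReal.ofReal (Real.exp (-(Λ * (c.length * δ)))) *
      ((δ : ℝ≥0∞) ^ c.reduceOption.length * (c.reduceOption.map fun i => (μ i : ℝ≥0∞)).prod) ≤
      P (⋂ i ∈ S, {ω | ∀ k : Fin c.length,
        N i ((k + 1 : ℕ) * δ) ω - N i ((k : ℕ) * δ) ω = if c.get k = some i then 1 else 0}) := by
    intro S hcS
    have h := hN.indep.measure_inter_preimage_eq_mul S
      (sets := fun i => {f : ℝ≥0 → ℕ | ∀ k : Fin c.length,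
      f ((k + 1 : ℕ) * δ) - f ((k : ℕ) * δ) = if c.get k = some i then 1 else 0})
      fun i _ => hmeas i
    refine le_of_le_of_eq ?_ h.symm
    have h2 : ∀ i ∈ S, P ((fun ω t => N i t ω) ⁻¹' {f : ℝ≥0 → ℕ | ∀ k : Fin c.length,
      f ((k + 1 : ℕ) * δ) - f ((k : ℕ) * δ) = if c.get k = some i then 1 else 0}) = _ :=
      fun i _ => measure_gridEvent_coordinate hN δ c i
    rw [Finset.prod_congr rfl h2, Finset.prod_comm]
    simp only [Finset.prod_mul_distrib]
    refine mul_le_mul' ?_ (le_of_eq ?_)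
    · rw [Finset.prod_const, Finset.card_univ, Fintype.card_fin,
        ← ENNReal.ofReal_prod_of_nonneg fun i _ => (Real.exp_pos _).le, ← Real.exp_sum,
        ← ENNReal.ofReal_pow (Real.exp_pos _).le, ← Real.exp_nat_mul]
      refine ENNReal.ofReal_le_ofReal (Real.exp_le_exp.2 ?_)
      have h3 : ∑ i ∈ S, (μ i : ℝ) ≤ Λ := by
        have := (ENNReal.sum_le_tsum S).trans_eq hΛ
        exact_mod_cast this
      rw [Finset.sum_neg_distrib, ← Finset.sum_mul]
      have h4 := mul_le_mul_of_nonneg_right h3 (show (0 : ℝ) ≤ c.length * δ by positivity)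
      linarith
    -- In slot `k` only its own mark contributes a factor other than one; `S` contains all marks of
    -- `c`.
    · have h5 : ∀ k : Fin c.length,
          (∏ i ∈ S, if c.get k = some i then (μ i * δ : ℝ≥0∞) else 1) =
          (c.get k).elim 1 fun i => (μ i * δ : ℝ≥0∞) := by
        intro k
        cases hk : c.get k with
        | none => simp
        | some a =>
          simp only [Option.some.injEq, Option.elim_some]
          rw [Finset.prod_ite_eq, if_pos]
          refine hcS (List.mem_toFinset.2 (List.reduceOption_mem_iff.2 ?_))
          rw [← hk]
          exact c.get_mem k
      rw [Finset.prod_congr rfl fun k _ => h5 k]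
      have h6 : ∏ k : Fin c.length, (c.get k).elim 1 (fun i => (μ i * δ : ℝ≥0∞)) =
          (c.map fun o => o.elim 1 (fun i => (μ i * δ : ℝ≥0∞))).prod := by
        rw [← List.prod_ofFn]
        congr 1
        conv_rhs => rw [← List.ofFn_get c, List.map_ofFn]
        rfl
      rw [h6]
      clear h6 h5 h2 h hmeas hcS
      induction c with
      | nil => simp
      | cons o c ih =>
        cases o with
        | none => simpa using ih
        | some a =>
          simp only [List.reduceOption_cons_of_some, List.length_cons, List.map_cons,
            List.prod_cons, Option.elim_some, ← ih]
          ring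
  rw [gridEvent, Set.iInter_eq_iInter_finset, Antitone.measure_iInter]
  · refine le_iInf fun S => (hS (S ∪ c.reduceOption.toFinset) Finset.subset_union_right).trans ?_
    refine measure_mono (Set.biInter_subset_biInter_left ?_)
    exact fun i hi => Finset.mem_union_left _ hi
  · exact fun S S' hSS' => Set.biInter_subset_biInter_left hSS'
  · intro S
    refine (Finset.measurableSet_biInter S fun i _ => ?_).nullMeasurableSet
    exact (measurable_pi_lambda _ (hN.poisson i).measurable) (hmeas i)
  · exact ⟨∅, measure_ne_top _ _⟩

/-- The probability that the marks of the history up to time `t` of a soup with intensity `μ` of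
total mass `Λ` are `σ`, in this order. -/
noncomputable def soupMass (μ : ι → ℝ≥0) (Λ t : ℝ≥0) (σ : List ι) : ℝ≥0∞ :=
  ENNReal.ofReal (Real.exp (-(Λ * t))) *
    (ENNReal.ofReal (t ^ σ.length / σ.length.factorial) * (σ.map fun i => (μ i : ℝ≥0∞)).prod)

theorem tsum_soupMass (hΛ : ∑' i, (μ i : ℝ≥0∞) = Λ) (t : ℝ≥0) : ∑' σ, soupMass μ Λ t σ = 1 := by
  simp only [soupMass]
  rw [ENNReal.tsum_mul_left, ENNReal.tsum_list_length]
  have h : ∀ j : ℕ, (∑' σ : List ι, if σ.length = j then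
      ENNReal.ofReal (t ^ σ.length / σ.length.factorial) * (σ.map fun i => (μ i : ℝ≥0∞)).prod
      else 0) = ENNReal.ofReal ((Λ * t : ℝ) ^ j / j.factorial) := by
    intro j
    have h1 : ∀ σ : List ι, (if σ.length = j then
      ENNReal.ofReal (t ^ σ.length / σ.length.factorial) * (σ.map fun i => (μ i : ℝ≥0∞)).prod
      else 0) = ENNReal.ofReal (t ^ j / j.factorial) *
        if σ.length = j then (σ.map fun i => (μ i : ℝ≥0∞)).prod else 0 := by
      intro σ
      split_ifs with h
      · rw [h]
      · simp
    simp only [h1]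
    rw [ENNReal.tsum_mul_left, ENNReal.tsum_list_length_prod, hΛ, ← ENNReal.ofReal_coe_nnreal,
      ← ENNReal.ofReal_pow Λ.coe_nonneg, ← ENNReal.ofReal_mul (by positivity)]
    congr 1
    ring
  simp only [h]
  have hs := NormedSpace.expSeries_div_hasSum_exp (Λ * t : ℝ)
  rw [← ENNReal.ofReal_tsum_of_nonneg (fun j => by positivity) hs.summable, hs.tsum_eq,
    ← Real.exp_eq_exp_ℝ, ← ENNReal.ofReal_mul (Real.exp_pos _).le, ← Real.exp_add]
  simp

/-- The event that in one of the grids of `n + 1` slots of `[0, t]`, the marks are `σ`. -/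
def markEvent (N : ι → ℝ≥0 → Ω → ℕ) (t : ℝ≥0) (σ : List ι) : Set Ω :=
  ⋃ n : ℕ, ⋃ c ∈ slots (n + 1) σ, gridEvent N (t / (n + 1 : ℕ)) c

/-- On the grid with `n + 1` slots, the arrangements of `σ` are disjoint events obeying the same
bound. Their number times `(t/(n+1))^j` tends to `t^j/j!`, the Poisson limit of the binomial. -/
theorem le_measure_markEvent [IsProbabilityMeasure P] [Countable ι] (hN : IsSoup N μ P)
    (hΛ : ∑' i, (μ i : ℝ≥0∞) = Λ)
    (t : ℝ≥0) (σ : List ι) : soupMass μ Λ t σ ≤ P (markEvent N t σ) := by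
  have hn : ∀ n : ℕ, ENNReal.ofReal (Real.exp (-(Λ * t))) *
      (ENNReal.ofReal ((n + 1).choose σ.length * (t / (n + 1 : ℕ) : ℝ) ^ σ.length) *
        (σ.map fun i => (μ i : ℝ≥0∞)).prod) ≤ P (markEvent N t σ) := by
    intro n
    refine le_trans ?_ (measure_mono (Set.subset_iUnion _ n))
    rw [measure_biUnion_finset]
    · have hc : ∀ c ∈ slots (n + 1) σ, ENNReal.ofReal (Real.exp (-(Λ * t))) *
          (ENNReal.ofReal ((t / (n + 1 : ℕ) : ℝ) ^ σ.length) *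
            (σ.map fun i => (μ i : ℝ≥0∞)).prod) ≤ P (gridEvent N (t / (n + 1 : ℕ)) c) := by
        intro c hc
        obtain ⟨h1, h2⟩ := length_of_mem_slots hc
        refine le_of_eq_of_le ?_ (le_measure_gridEvent hN hΛ _ c)
        rw [h1, h2]
        congr 2
        · congr 3
          push_cast
          field_simp
        · rw [ENNReal.ofReal_pow (by positivity)]
          congr 1
          rw [← NNReal.coe_natCast, ← NNReal.coe_div, ENNReal.ofReal_coe_nnreal]
      refine le_of_eq_of_le ?_ (Finset.sum_le_sum hc)
      rw [Finset.sum_const, card_slots, nsmul_eq_mul, ENNReal.ofReal_mul (by positivity),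
        ENNReal.ofReal_natCast]
      ring
    · intro c hc c' hc' hne
      exact disjoint_gridEvent _
        ((length_of_mem_slots hc).1.trans (length_of_mem_slots hc').1.symm) hne
    · exact fun c _ => measurableSet_gridEvent hN _ c
  refine le_of_tendsto' (x := Filter.atTop) ?_ hn
  refine ENNReal.Tendsto.const_mul (ENNReal.Tendsto.mul_const (ENNReal.tendsto_ofReal ?_) ?_) ?_
  · have h := tendsto_choose_mul_pow_atTop (p := fun n => t / (n : ℝ)) (r := t) σ.length (by
      refine tendsto_const_nhds.congr' ?_
      filter_upwards [Filter.eventually_ne_atTop 0] with n hn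
      field_simp)
    exact h.comp (Filter.tendsto_add_atTop_nat 1)
  · right
    have : (σ.map fun i => (μ i : ℝ≥0∞)).prod = ((σ.map μ).prod : ℝ≥0) := by
      clear hn
      induction σ with
      | nil => simp
      | cons a σ ih => simp [ih]
    rw [this]
    exact ENNReal.coe_ne_top
  · right
    exact ENNReal.ofReal_ne_top

theorem IsSoup.ae_isHistory_of_mem_markEvent [Countable ι] (hN : IsSoup N μ P) (t : ℝ≥0) :
    ∀ᵐ ω ∂P, ∀ σ, ω ∈ markEvent N t σ →
      ∃ h, IsHistory (fun i s => N i s ω) t h ∧ h.map Prod.snd = σ := by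
  filter_upwards [ae_all_iff.2 fun i => (hN.poisson i).start,
    ae_all_iff.2 fun i => (hN.poisson i).paths] with ω h0 hpaths σ hω
  simp only [markEvent, Set.mem_iUnion] at hω
  obtain ⟨n, c, hc, hω⟩ := hω
  obtain ⟨h1, h2⟩ := length_of_mem_slots hc
  have h := exists_isHistory_of_grid (n := fun i s => N i s ω) h0 (fun i => (hpaths i).1)
    (fun i => (hpaths i).2) _ c (fun i => Set.mem_iInter.1 hω i)
  rw [h1, h2] at h
  rwa [mul_div_cancel₀ _ (by positivity)] at h

/-- Disjoint events whose lower bounds already add up to one leave no room for excess, so no upper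
estimate is needed. -/
theorem measure_eq_of_le_of_tsum_eq_one [IsProbabilityMeasure P] {κ : Type*} [Countable κ] {F : κ → Set Ω} {c : κ → ℝ≥0∞}
    (hF : ∀ σ, MeasurableSet (F σ)) (hd : Pairwise (Function.onFun (AEDisjoint P) F))
    (hc : ∀ σ, c σ ≤ P (F σ)) (hsum : ∑' σ, c σ = 1) :
    (∀ σ, P (F σ) = c σ) ∧ ∀ᵐ ω ∂P, ∃ σ, ω ∈ F σ := by
  have hU := measure_iUnion₀ hd fun σ => (hF σ).nullMeasurableSet
  have h1 : P (⋃ σ, F σ) = 1 :=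
    le_antisymm prob_le_one (by
      rw [hU, ← hsum]
      exact ENNReal.tsum_le_tsum hc)
  refine ⟨fun σ => le_antisymm ?_ (hc σ), ?_⟩
  · by_contra hlt
    have h2 := ENNReal.tsum_lt_tsum (by rw [hsum]; simp) hc (not_le.1 hlt)
    rw [hsum, ← hU, h1] at h2
    exact lt_irrefl _ h2
  · have h2 := (prob_compl_eq_zero_iff (MeasurableSet.iUnion hF)).2 h1
    filter_upwards [measure_eq_zero_iff_ae_notMem.1 h2] with ω hω
    simpa using hω

theorem IsSoup.measure_markEvent [IsProbabilityMeasure P] [Countable ι] (hN : IsSoup N μ P)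
    (hΛ : ∑' i, (μ i : ℝ≥0∞) = Λ) (t : ℝ≥0) :
    (∀ σ, MeasurableSet (markEvent N t σ)) ∧
    Pairwise (Function.onFun (AEDisjoint P) (markEvent N t)) ∧
    (∀ σ, P (markEvent N t σ) = soupMass μ Λ t σ) ∧ ∀ᵐ ω ∂P, ∃ σ, ω ∈ markEvent N t σ := by
  have hmeas : ∀ σ, MeasurableSet (markEvent N t σ) := fun σ =>
    MeasurableSet.iUnion fun n => Finset.measurableSet_biUnion _ fun c _ =>
      measurableSet_gridEvent hN _ c
  -- Disjointness up to a null set comes from uniqueness of the history, across all grids at once.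
  have hd : Pairwise (Function.onFun (AEDisjoint P) (markEvent N t)) := by
    intro σ σ' hne
    rw [Function.onFun, AEDisjoint, measure_eq_zero_iff_ae_notMem]
    filter_upwards [hN.ae_isHistory_of_mem_markEvent t] with ω hω hmem
    obtain ⟨h, H, rfl⟩ := hω σ hmem.1
    obtain ⟨h', H', rfl⟩ := hω σ' hmem.2
    exact hne (by rw [H.unique H'])
  exact ⟨hmeas, hd, measure_eq_of_le_of_tsum_eq_one hmeas hd (le_measure_markEvent hN hΛ t)
    (tsum_soupMass hΛ t)⟩

theorem IsSoup.ae_exists_isHistory [IsProbabilityMeasure P] [Countable ι] (hN : IsSoup N μ P)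
    (hΛ : ∑' i, (μ i : ℝ≥0∞) = Λ) (t : ℝ≥0) :
    ∀ᵐ ω ∂P, ∃ h, IsHistory (fun i s => N i s ω) t h := by
  filter_upwards [(hN.measure_markEvent hΛ t).2.2.2, hN.ae_isHistory_of_mem_markEvent t]
    with ω ⟨σ, hσ⟩ hω
  obtain ⟨h, H, -⟩ := hω σ hσ
  exact ⟨h, H⟩

open Classical in
/-- The law of a function of the marks of the history of a soup. -/
theorem IsSoup.map_history [IsProbabilityMeasure P] [Countable ι] (hN : IsSoup N μ P)
    (hΛ : ∑' i, (μ i : ℝ≥0∞) = Λ)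
    (t : ℝ≥0) {β : Type*} [MeasurableSpace β] [Countable β] [DiscreteMeasurableSpace β]
    [Nonempty β] {Y : Ω → β} (f : List ι → β)
    (hY : ∀ ω h, IsHistory (fun i s => N i s ω) t h → Y ω = f (h.map Prod.snd)) :
    AEMeasurable Y P ∧ ∀ b, P.map Y {b} = ∑' σ, if f σ = b then soupMass μ Λ t σ else 0 := by
  obtain ⟨hmeas, hd, hP, hex⟩ := hN.measure_markEvent hΛ t
  -- `Y` is arbitrary where no history exists; that event is null, so `Y` is only almost everywhere
  -- measurable.
  have hpre : ∀ B : Set β, Y ⁻¹' B =ᵐ[P] ⋃ σ : {σ // f σ ∈ B}, markEvent N t σ := by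
    intro B
    rw [Filter.eventuallyEq_set]
    filter_upwards [hex, hN.ae_isHistory_of_mem_markEvent t] with ω ⟨σ, hσ⟩ hω
    have hf : ∀ σ, ω ∈ markEvent N t σ → Y ω = f σ := fun σ hσ => by
      obtain ⟨h, H, rfl⟩ := hω σ hσ
      exact hY ω h H
    rw [Set.mem_preimage, Set.mem_iUnion]
    constructor
    · exact fun h => ⟨⟨σ, hf σ hσ ▸ h⟩, hσ⟩
    · rintro ⟨⟨σ', h⟩, hσ'⟩
      rwa [hf σ' hσ']
  have hae : AEMeasurable Y P := by
    refine NullMeasurable.aemeasurable fun B _ => ?_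
    exact (MeasurableSet.iUnion fun σ : {σ // f σ ∈ B} =>
      hmeas σ).nullMeasurableSet.congr (hpre B).symm
  refine ⟨hae, fun b => ?_⟩
  rw [Measure.map_apply_of_aemeasurable hae (measurableSet_singleton b), measure_congr (hpre {b}),
    measure_iUnion₀ (f := fun σ : {σ // f σ ∈ ({b} : Set β)} => markEvent N t σ)
      (fun σ σ' hne => hd fun h => hne (Subtype.ext h))
      fun σ => (hmeas σ).nullMeasurableSet]
  simp only [hP]
  refine (tsum_subtype {σ | f σ ∈ ({b} : Set β)} (soupMass μ Λ t)).trans ?_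
  refine tsum_congr fun σ => ?_
  simp [Set.indicator_apply]

end Soup

/-! ### Coefficients of the powers of `-log (1 - z)` -/

/-- The power series of `-log (1 - z)`. -/
noncomputable def logSeries : PowerSeries ℝ :=
  -- The convention `0⁻¹ = 0` supplies the vanishing constant term.
  PowerSeries.mk fun n => (n : ℝ)⁻¹

/-- The coefficient of `z ^ k` in `(-log (1 - z)) ^ j`. -/
noncomputable def logCoeff (k j : ℕ) : ℝ :=
  PowerSeries.coeff k (logSeries ^ j)

theorem logCoeff_zero_right (k : ℕ) : logCoeff k 0 = if k = 0 then 1 else 0 := by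
  simp [logCoeff, PowerSeries.coeff_one]

/-- Here `i` is the first part of a composition of `k` into `j + 1` positive parts. -/
theorem logCoeff_succ (k j : ℕ) :
    logCoeff k (j + 1) = ∑ i ∈ Finset.Icc 1 k, (i : ℝ)⁻¹ * logCoeff (k - i) j := by
  rw [logCoeff, pow_succ', PowerSeries.coeff_mul,
    Finset.Nat.sum_antidiagonal_eq_sum_range_succ_mk, Finset.sum_range_succ']
  simp only [logSeries, PowerSeries.coeff_mk, Nat.cast_zero, inv_zero, zero_mul, add_zero]
  rw [Finset.range_eq_Ico, Finset.sum_Ico_add' (fun i : ℕ => (i : ℝ)⁻¹ *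
    PowerSeries.coeff (k - i) (PowerSeries.mk (fun n : ℕ => (n : ℝ)⁻¹) ^ j)) 0 k 1]
  rfl

theorem logCoeff_nonneg (k j : ℕ) : 0 ≤ logCoeff k j := by
  induction j generalizing k with
  | zero =>
    rw [logCoeff_zero_right]
    split_ifs <;> simp
  | succ j ih =>
    rw [logCoeff_succ]
    exact Finset.sum_nonneg fun i _ => mul_nonneg (by positivity) (ih _)

theorem logCoeff_eq_zero {k j : ℕ} (h : k < j) : logCoeff k j = 0 := by
  induction j generalizing k with
  | zero => omega
  | succ j ih =>
    rw [logCoeff_succ]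
    refine Finset.sum_eq_zero fun i hi => ?_
    rw [Finset.mem_Icc] at hi
    rw [ih (by omega), mul_zero]

/-- With `L = -log(1-z)`, this compares coefficients in `(L^(j+1))' = (j+1) L^j / (1-z)`; dividing
by `1 - z` takes partial sums. -/
theorem succ_mul_logCoeff (k j : ℕ) :
    (k + 1) * logCoeff (k + 1) (j + 1) = (j + 1) * ∑ i ∈ Finset.range (k + 1), logCoeff i j := by
  have hd : PowerSeries.derivative ℝ logSeries = PowerSeries.mk fun _ => 1 := by
    ext n
    rw [PowerSeries.coeff_derivative, logSeries, PowerSeries.coeff_mk, PowerSeries.coeff_mk]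
    have : ((n : ℝ) + 1) ≠ 0 := by positivity
    push_cast
    field_simp
  have h1 := PowerSeries.coeff_derivative (logSeries ^ (j + 1)) k
  rw [PowerSeries.derivative_pow, hd, Nat.add_sub_cancel, mul_assoc, ← map_natCast PowerSeries.C,
    PowerSeries.coeff_C_mul, PowerSeries.coeff_mul,
    Finset.Nat.sum_antidiagonal_eq_sum_range_succ_mk] at h1
  simp only [PowerSeries.coeff_mk, mul_one] at h1
  rw [mul_comm, logCoeff, ← h1]
  push_cast
  rfl

/-- The sum over the compositions of `k`, weighted by the inverses of the parts, of
`t ^ j / j!`, `j` the number of parts. -/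
theorem sum_logCoeff {t : ℝ} (ht : 0 < t) (k : ℕ) :
    ∑ j ∈ Finset.range (k + 1), t ^ j / j.factorial * logCoeff k j =
      Real.Gamma (k + t) / (k.factorial * Real.Gamma t) := by
  have hext : ∀ k N : ℕ, k ≤ N → ∑ j ∈ Finset.range (k + 1), t ^ j / j.factorial * logCoeff k j =
      ∑ j ∈ Finset.range (N + 1), t ^ j / j.factorial * logCoeff k j := by
    intro k N hkN
    refine Finset.sum_subset (Finset.range_mono (by omega)) fun j _ hj => ?_
    rw [Finset.mem_range, not_lt] at hj
    rw [logCoeff_eq_zero (by omega), mul_zero]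
  obtain ⟨a, ha⟩ : ∃ a : ℕ → ℝ, ∀ k, a k =
    ∑ j ∈ Finset.range (k + 1), t ^ j / j.factorial * logCoeff k j := ⟨_, fun _ => rfl⟩
  -- For `F = ∑ a k z^k` this is the equation `F' = t F / (1-z)` of `(1-z)^(-t)`.
  have hrec : ∀ k : ℕ, (k + 1) * a (k + 1) = t * ∑ i ∈ Finset.range (k + 1), a i := by
    intro k
    have h1 : ∑ i ∈ Finset.range (k + 1), a i =
        ∑ i ∈ Finset.range (k + 1), ∑ j ∈ Finset.range (k + 1),
          t ^ j / j.factorial * logCoeff i j :=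
      Finset.sum_congr rfl fun i hi =>
        (ha i).trans (hext i k (by simpa [Nat.lt_succ_iff] using hi))
    rw [h1, Finset.sum_comm, ha, Finset.sum_range_succ', logCoeff_zero_right, if_neg (by omega), mul_zero, add_zero,
      Finset.mul_sum, Finset.mul_sum]
    refine Finset.sum_congr rfl fun j _ => ?_
    rw [← Finset.mul_sum]
    have h2 := succ_mul_logCoeff k j
    have h3 : (k + 1 : ℝ) * (t ^ (j + 1) / (j + 1).factorial * logCoeff (k + 1) (j + 1)) =
        t ^ (j + 1) / (j + 1).factorial * ((k + 1) * logCoeff (k + 1) (j + 1)) := by ring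
    rw [h3, h2, Nat.factorial_succ]
    have : ((j : ℝ) + 1) ≠ 0 := by positivity
    have : (j.factorial : ℝ) ≠ 0 := by positivity
    push_cast
    field_simp
    ring
  -- Consecutive partial sums are subtracted; the result is the recursion of the Gamma quotient.
  have hstep : ∀ k : ℕ, (k + 1) * a (k + 1) = (k + t) * a k := by
    intro k
    cases k with
    | zero =>
      rw [hrec]
      simp
    | succ k =>
      rw [hrec, Finset.sum_range_succ, mul_add, ← hrec]
      push_cast
      ring
  have hΓ := (Real.Gamma_pos_of_pos ht).ne'
  rw [← ha]
  induction k with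
  | zero => simp [ha, logCoeff_zero_right, hΓ]
  | succ k ih =>
    have h1 : a (k + 1) = (k + t) * a k / (k + 1) := by
      rw [← hstep]
      field_simp
    rw [h1, ih, Nat.cast_succ, add_right_comm, Real.Gamma_add_one (by positivity),
      Nat.factorial_succ]
    have : (k.factorial : ℝ) ≠ 0 := by positivity
    push_cast
    field_simp

theorem tsum_logCoeff {t : ℝ} (ht : 0 < t) (k : ℕ) :
    ∑' j : ℕ, ENNReal.ofReal (t ^ j / j.factorial) * ENNReal.ofReal (logCoeff k j) =
      ENNReal.ofReal (Real.Gamma (k + t) / (k.factorial * Real.Gamma t)) := by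
  rw [← sum_logCoeff ht, tsum_eq_sum (s := Finset.range (k + 1)),
    ENNReal.ofReal_sum_of_nonneg fun j _ => mul_nonneg (by positivity) (logCoeff_nonneg k j)]
  · exact Finset.sum_congr rfl fun j _ => (ENNReal.ofReal_mul (by positivity)).symm
  · intro j hj
    rw [Finset.mem_range, not_lt] at hj
    rw [logCoeff_eq_zero (by omega), ENNReal.ofReal_zero, mul_zero]

/-! ### Loops and their decompositions -/

section Loops

variable {V : Type*} {A : Finset V} {x : V}

/-- In this form concatenation of loops is the appending of tails, and `r.count x` is the number of
returns. The condition on the last element is vacuous for the trivial loop. -/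
theorem mem_loopsAt_iff (hx : x ∈ A) {l : List V} :
    l ∈ loopsAt A x ↔ ∃ r, l = x :: r ∧ (∀ v ∈ r, v ∈ A) ∧ ∀ v ∈ r.getLast?, v = x := by
  constructor
  · rintro ⟨h1, h2, y, rfl, h3⟩
    cases l with
    | nil => simp at h1
    | cons u r =>
      obtain rfl : u = y := by simpa using h1
      refine ⟨r, rfl, ?_, ?_⟩
      · rcases List.eq_nil_or_concat r with rfl | ⟨r, v, rfl⟩
        · simp
        · simp only [List.concat_eq_append] at h2 h3 ⊢
          rw [← List.cons_append, List.dropLast_concat] at h2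
          rw [← List.cons_append, List.getLast?_concat] at h3
          obtain rfl : v = u := by simpa using h3
          intro w hw
          rw [List.mem_append, List.mem_singleton] at hw
          obtain hw | rfl := hw
          · exact h2 w (List.mem_cons_of_mem _ hw)
          · exact hx
      · intro v hv
        rw [List.getLast?_cons, Option.mem_def.1 hv] at h3
        simpa using h3
  · rintro ⟨r, rfl, h1, h2⟩
    refine ⟨rfl, ?_, x, rfl, ?_⟩
    · intro v hv
      obtain rfl | hv := List.mem_cons.1 (List.mem_of_mem_dropLast hv)
      · exact hx
      · exact h1 v hv
    · rw [List.getLast?_cons]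
      cases h : r.getLast? with
      | none => rfl
      | some v => rw [Option.getD_some, h2 v h]

theorem trivial_mem_loopsAt (A : Finset V) (x : V) : [x] ∈ loopsAt A x :=
  ⟨rfl, by simp, x, rfl, rfl⟩

theorem walkConcat_mem_loopsAt [DecidableEq V] (hx : x ∈ A) {l₁ l₂ : List V} (h₁ : l₁ ∈ loopsAt A x)
    (h₂ : l₂ ∈ loopsAt A x) : walkConcat l₁ l₂ ∈ loopsAt A x ∧
      (walkConcat l₁ l₂).tail.count x = l₁.tail.count x + l₂.tail.count x := by
  obtain ⟨r₁, rfl, h₁, h₁'⟩ := (mem_loopsAt_iff hx).1 h₁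
  obtain ⟨r₂, rfl, h₂, h₂'⟩ := (mem_loopsAt_iff hx).1 h₂
  refine ⟨(mem_loopsAt_iff hx).2 ⟨r₁ ++ r₂, rfl, ?_, ?_⟩, by simp [walkConcat]⟩
  · intro v hv
    exact (List.mem_append.1 hv).elim (h₁ v) (h₂ v)
  · intro v hv
    rw [List.getLast?_append] at hv
    cases h : r₂.getLast? with
    | none =>
      rw [h, Option.none_or] at hv
      exact h₁' v hv
    | some w =>
      rw [h, Option.some_or] at hv
      exact h₂' v (h.trans hv)

theorem walkMass_walkConcat (p : V → V → ℝ) (hx : x ∈ A) {l₁ l₂ : List V} (h₁ : l₁ ∈ loopsAt A x)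
    (h₂ : l₂ ∈ loopsAt A x) :
    walkMass p (walkConcat l₁ l₂) = walkMass p l₁ * walkMass p l₂ := by
  obtain ⟨r₁, rfl, h₁, h₁'⟩ := (mem_loopsAt_iff hx).1 h₁
  obtain ⟨r₂, rfl, h₂, h₂'⟩ := (mem_loopsAt_iff hx).1 h₂
  rcases List.eq_nil_or_concat r₁ with rfl | ⟨r, v, rfl⟩
  · simp [walkConcat, walkMass]
  · obtain rfl : v = x := by simpa using h₁'
    have := walkMass_append p (v :: r) v r₂
    simpa [walkConcat] using this

theorem concatLoops_mem_loopsAt [DecidableEq V] (hx : x ∈ A) (σ : List (nontrivialLoops A x)) :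
    concatLoops x (σ.map Subtype.val) ∈ loopsAt A x := by
  induction σ with
  | nil => exact trivial_mem_loopsAt A x
  | cons l σ ih => exact (walkConcat_mem_loopsAt hx l.2.1 ih).1

theorem count_tail_eq_zero_iff [DecidableEq V] (hx : x ∈ A) {l : List V} (hl : l ∈ loopsAt A x) :
    l.tail.count x = 0 ↔ l = [x] := by
  obtain ⟨r, rfl, -, h⟩ := (mem_loopsAt_iff hx).1 hl
  constructor
  · intro h0
    rcases List.eq_nil_or_concat r with rfl | ⟨r, v, rfl⟩
    · rfl
    · obtain rfl : v = x := by simpa using h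
      simp at h0
  · intro h
    simp [h]

/-- One of `r₁`, `s₁` is a prefix of the other. The surplus contains no `x` but would have to end at
`x`, so it is empty. -/
theorem eq_of_append_eq_append [DecidableEq V] {r₁ r₂ s₁ s₂ : List V} (h : r₁ ++ r₂ = s₁ ++ s₂)
    (hr : ∀ v ∈ r₁.getLast?, v = x) (hs : ∀ v ∈ s₁.getLast?, v = x)
    (hc : r₁.count x = s₁.count x) : r₁ = s₁ ∧ r₂ = s₂ := by
  have key : ∀ a c : List V, (∀ v ∈ (a ++ c).getLast?, v = x) → a.count x = (a ++ c).count x →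
      c = [] := by
    intro a c h1 h2
    rcases List.eq_nil_or_concat c with rfl | ⟨c, v, rfl⟩
    · rfl
    · obtain rfl : v = x := by simpa using h1
      simp at h2
  obtain ⟨a, rfl, rfl⟩ | ⟨a, rfl, rfl⟩ := List.append_eq_append_iff.1 h
  · obtain rfl := key r₁ a hs hc
    simp
  · obtain rfl := key s₁ a hr hc.symm
    simp

theorem exists_append_of_le_count [DecidableEq V] (x : V) (r : List V) {i : ℕ} (hi : i ≤ r.count x) :
    ∃ r₁ r₂, r = r₁ ++ r₂ ∧ (∀ v ∈ r₁.getLast?, v = x) ∧ r₁.count x = i := by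
  induction r generalizing i with
  | nil => exact ⟨[], [], rfl, by simp, by simpa [eq_comm] using hi⟩
  | cons u r ih =>
    obtain rfl | hi0 := Nat.eq_zero_or_pos i
    · exact ⟨[], u :: r, rfl, by simp, rfl⟩
    · have hcons : ∀ r₁ : List V, (∀ v ∈ r₁.getLast?, v = x) → (r₁ = [] → u = x) →
          ∀ v ∈ (u :: r₁).getLast?, v = x := by
        intro r₁ h1 h2 v hv
        rw [List.getLast?_cons] at hv
        cases h : r₁.getLast? with
        | none =>
          rw [h] at hv
          rw [← h2 (List.getLast?_eq_none_iff.1 h)]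
          simpa using hv.symm
        | some w =>
          rw [h] at hv
          obtain rfl : w = v := by simpa using hv
          exact h1 w h
      by_cases hu : u = x
      · subst hu
        rw [List.count_cons_self] at hi
        obtain ⟨r₁, r₂, rfl, h1, h2⟩ := ih (i := i - 1) (by omega)
        refine ⟨u :: r₁, r₂, rfl, hcons r₁ h1 fun _ => rfl, ?_⟩
        rw [List.count_cons_self]
        omega
      · rw [List.count_cons_of_ne hu] at hi
        obtain ⟨r₁, r₂, rfl, h1, h2⟩ := ih hi
        refine ⟨u :: r₁, r₂, rfl, hcons r₁ h1 ?_, by rw [List.count_cons_of_ne hu, h2]⟩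
        rintro rfl
        rw [List.count_nil] at h2
        omega

/-- The cut is made at the `i`-th return. By `eq_of_walkConcat_eq` it is the only such cut, so pairs
of factors are indexed by the number of returns of the first one. -/
theorem exists_walkConcat_eq [DecidableEq V] (hx : x ∈ A) {l : List V} (hl : l ∈ loopsAt A x) {i : ℕ}
    (hi : i ≤ l.tail.count x) : ∃ l₁ ∈ loopsAt A x, ∃ l₂ ∈ loopsAt A x,
      walkConcat l₁ l₂ = l ∧ l₁.tail.count x = i := by
  obtain ⟨r, rfl, h, h'⟩ := (mem_loopsAt_iff hx).1 hl
  obtain ⟨r₁, r₂, rfl, h1, h2⟩ := exists_append_of_le_count x r hi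
  refine ⟨x :: r₁, (mem_loopsAt_iff hx).2 ⟨r₁, rfl, fun v hv => h v (List.mem_append_left _ hv),
    h1⟩, x :: r₂, (mem_loopsAt_iff hx).2 ⟨r₂, rfl, fun v hv => h v (List.mem_append_right _ hv),
    fun v hv => h' v ?_⟩, rfl, h2⟩
  rw [List.getLast?_append, Option.mem_def.1 hv]
  rfl

theorem eq_of_walkConcat_eq [DecidableEq V] (hx : x ∈ A) {l₁ l₂ l₁' l₂' : List V} (h₁ : l₁ ∈ loopsAt A x)
    (h₂ : l₂ ∈ loopsAt A x) (h₁' : l₁' ∈ loopsAt A x) (h₂' : l₂' ∈ loopsAt A x)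
    (h : walkConcat l₁ l₂ = walkConcat l₁' l₂') (hc : l₁.tail.count x = l₁'.tail.count x) :
    l₁ = l₁' ∧ l₂ = l₂' := by
  obtain ⟨r₁, rfl, -, h₁⟩ := (mem_loopsAt_iff hx).1 h₁
  obtain ⟨r₂, rfl, -, -⟩ := (mem_loopsAt_iff hx).1 h₂
  obtain ⟨s₁, rfl, -, h₁'⟩ := (mem_loopsAt_iff hx).1 h₁'
  obtain ⟨s₂, rfl, -, -⟩ := (mem_loopsAt_iff hx).1 h₂'
  have := eq_of_append_eq_append (by simpa [walkConcat] using h) h₁ h₁' hc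
  simpa using this

theorem loopsOfOrder_subset [DecidableEq V] (hx : x ∈ A) (k : ℕ) :
    ∀ l ∈ loopsOfOrder A x k, l ∈ loopsAt A x ∧ l.tail.count x = k := by
  induction k with
  | zero =>
    rintro l rfl
    exact ⟨trivial_mem_loopsAt A x, rfl⟩
  | succ k ih =>
    rintro l ⟨l₁, h₁, l₂, h₂, rfl⟩
    obtain ⟨h₂, hc₂⟩ := ih l₂ h₂
    obtain ⟨h, hc⟩ := walkConcat_mem_loopsAt hx h₁.1.1 h₂
    refine ⟨h, ?_⟩
    have : l₁.tail.count x = 1 := by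
      obtain ⟨⟨h₁, hne⟩, hel⟩ := h₁
      obtain ⟨r, rfl, -, hr⟩ := (mem_loopsAt_iff hx).1 h₁
      rcases List.eq_nil_or_concat r with rfl | ⟨r, v, rfl⟩
      · exact absurd rfl hne
      · obtain rfl : v = x := by simpa using hr
        simp only [List.concat_eq_append, List.tail_cons, List.dropLast_concat] at hel
        simp [List.count_eq_zero_of_not_mem hel]
    omega

variable {p : V → V → ℝ}

theorem walkMass_loop (hpos : IsPositiveWeight A p) {T : Set V} {l : List V}
    (hl : l ∈ walks A x T) : 0 ≤ walkWeight p l ∧ walkMass p l = ENNReal.ofReal (walkWeight p l) :=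
  walkMass_eq_ofReal hpos l hl.2.1

theorem rootedLoopMass_eq [DecidableEq V] (hpos : IsPositiveWeight A p) (l : nontrivialLoops A x) :
    (rootedLoopMass p x l : ℝ≥0∞) =
      ENNReal.ofReal ((l : List V).tail.count x : ℝ)⁻¹ * walkMass p l := by
  rw [(walkMass_loop hpos l.2.1).2, ← ENNReal.ofReal_mul (by positivity), mul_comm, ← div_eq_mul_inv]
  rfl

/-- The total mass of the lists of `j` nontrivial loops with concatenation `l`. -/
theorem tsum_concatLoops_length [DecidableEq V] (hpos : IsPositiveWeight A p) (hx : x ∈ A) (j : ℕ) {l : List V}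
    (hl : l ∈ loopsAt A x) :
    (∑' σ : List (nontrivialLoops A x), if σ.length = j then
      if concatLoops x (σ.map Subtype.val) = l then
        (σ.map fun l => (rootedLoopMass p x l : ℝ≥0∞)).prod else 0 else 0) =
      ENNReal.ofReal (logCoeff (l.tail.count x) j) * walkMass p l := by
  classical
  induction j generalizing l with
  | zero =>
    rw [tsum_eq_single [], logCoeff_zero_right]
    · simp only [List.length_nil, if_true, List.map_nil, concatLoops,
        List.prod_nil, count_tail_eq_zero_iff hx hl]
      by_cases h : l = [x]
      · simp [h, walkMass]
      · simp [h, Ne.symm h]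
    · intro σ hσ
      simp [List.length_eq_zero_iff, hσ]
  | succ j ih =>
    -- `q i` is the cut at the `i`-th return; `i ≥ 1` because the first loop is nontrivial.
    have hsplit : ∀ i : Finset.Icc 1 (l.tail.count x), ∃ q : nontrivialLoops A x × List V,
        q.2 ∈ loopsAt A x ∧ walkConcat q.1 q.2 = l ∧ (q.1 : List V).tail.count x = i := by
      intro i
      obtain ⟨hi1, hi2⟩ := Finset.mem_Icc.1 i.2
      obtain ⟨l₁, h₁, l₂, h₂, h, hc⟩ := exists_walkConcat_eq hx hl hi2
      refine ⟨(⟨l₁, h₁, fun h1 => ?_⟩, l₂), h₂, h, hc⟩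
      rw [(count_tail_eq_zero_iff hx h₁).2 h1] at hc
      omega
    choose q hq2 hq hqc using hsplit
    have hcount : ∀ i, (q i).2.tail.count x = l.tail.count x - i := by
      intro i
      have := (walkConcat_mem_loopsAt hx (q i).1.2.1 (hq2 i)).2
      rw [hq, hqc] at this
      omega
    -- At most one index `i`, the number of returns of `a`, can contribute.
    have hite : ∀ (a : nontrivialLoops A x) (σ : List (nontrivialLoops A x)) (c : ℝ≥0∞),
        (if walkConcat (a : List V) (concatLoops x (σ.map Subtype.val)) = l
          then c else 0) = ∑ i, if a = (q i).1 then
            if concatLoops x (σ.map Subtype.val) = (q i).2 then c else 0 else 0 := by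
      intro a σ c
      have hσ := concatLoops_mem_loopsAt hx σ
      split_ifs with h
      · have hk := (walkConcat_mem_loopsAt hx a.2.1 hσ).2
        rw [h] at hk
        have ha : 1 ≤ (a : List V).tail.count x :=
          Nat.one_le_iff_ne_zero.2 fun h0 => a.2.2 ((count_tail_eq_zero_iff hx a.2.1).1 h0)
        let i₀ : Finset.Icc 1 (l.tail.count x) :=
          ⟨(a : List V).tail.count x, Finset.mem_Icc.2 ⟨ha, by omega⟩⟩
        obtain ⟨h1, h2⟩ := eq_of_walkConcat_eq hx a.2.1 hσ (q i₀).1.2.1 (hq2 i₀)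
          (h.trans (hq i₀).symm) (hqc i₀).symm
        rw [Finset.sum_eq_single i₀]
        · rw [if_pos (Subtype.ext h1), if_pos h2]
        · intro i _ hi
          rw [if_neg]
          rintro rfl
          exact hi (Subtype.ext (hqc i).symm)
        · simp
      · refine (Finset.sum_eq_zero fun i _ => ?_).symm
        split_ifs with h1 h2
        · exact absurd (by rw [h1, h2, hq]) h
        · rfl
        · rfl
    rw [ENNReal.tsum_list]
    simp only [List.length_nil, Nat.right_eq_add, Nat.add_eq_zero_iff, one_ne_zero, and_false,
      if_false, zero_add, List.length_cons, Nat.add_right_cancel_iff, List.map_cons, List.prod_cons]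
    have hcons : ∀ (a : nontrivialLoops A x) (σ : List (nontrivialLoops A x)),
        (if σ.length = j then
          if concatLoops x ((a : List V) :: σ.map Subtype.val) = l then
            (rootedLoopMass p x a : ℝ≥0∞) * (σ.map fun l => (rootedLoopMass p x l : ℝ≥0∞)).prod
          else 0 else 0) =
        ∑ i, if a = (q i).1 then rootedLoopMass p x a * (if σ.length = j then
          if concatLoops x (σ.map Subtype.val) = (q i).2 then
            (σ.map fun l => (rootedLoopMass p x l : ℝ≥0∞)).prod else 0 else 0) else 0 := by
      intro a σ
      have h1 : concatLoops x ((a : List V) :: σ.map Subtype.val) =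
        walkConcat a (concatLoops x (σ.map Subtype.val)) := rfl
      by_cases h : σ.length = j
      · simp only [h, if_true, h1, hite]
        refine Finset.sum_congr rfl fun i _ => ?_
        split_ifs <;> simp
      · simp [h]
    have hswap : ∀ a : nontrivialLoops A x, (∑' σ : List (nontrivialLoops A x),
        if σ.length = j then
          if concatLoops x ((a : List V) :: σ.map Subtype.val) = l then
            (rootedLoopMass p x a : ℝ≥0∞) * (σ.map fun l => (rootedLoopMass p x l : ℝ≥0∞)).prod
          else 0 else 0) = ∑ i, if a = (q i).1 then (rootedLoopMass p x a : ℝ≥0∞) *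
            (ENNReal.ofReal (logCoeff (l.tail.count x - i) j) * walkMass p (q i).2) else 0 := by
      intro a
      simp only [hcons]
      rw [Summable.tsum_finsetSum fun i _ => ENNReal.summable]
      refine Finset.sum_congr rfl fun i _ => ?_
      split_ifs
      · rw [ENNReal.tsum_mul_left, ih (hq2 i), hcount]
      · simp
    simp only [hswap]
    rw [Summable.tsum_finsetSum fun i _ => ENNReal.summable]
    refine (Finset.sum_congr rfl fun i _ => tsum_ite_eq _ _).trans ?_
    rw [logCoeff_succ, ENNReal.ofReal_sum_of_nonneg fun i _ => mul_nonneg (by positivity)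
      (logCoeff_nonneg _ _), Finset.sum_mul, ← Finset.sum_coe_sort (Finset.Icc 1 _)]
    refine Finset.sum_congr rfl fun i _ => ?_
    -- The division by the number of returns in `m'` produces the factor `1/i` of `logCoeff_succ`.
    rw [rootedLoopMass_eq hpos, hqc, ENNReal.ofReal_mul (by positivity)]
    have h1 := walkMass_walkConcat p hx (q i).1.2.1 (hq2 i)
    rw [hq] at h1
    rw [h1]
    ring

end Loops

instance discreteMeasurableSpace_walk {V : Type*} : DiscreteMeasurableSpace (List V) :=
  ⟨fun _ => trivial⟩

/-! ### The total mass of the loops at a vertex -/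

section LoopMass

variable {V : Type*} {A B : Finset V} {p : V → V → ℝ} {x : V}

/-- The total weight of the loops at a vertex, as an extended nonnegative real. -/
noncomputable def loopMass (A : Finset V) (p : V → V → ℝ) (x : V) : ℝ≥0∞ :=
  ∑' l : loopsAt A x, walkMass p l

/-- Covers an endpoint of `η` on the boundary, where the erased loop is trivial and the Green's
function is one. -/
theorem loopsAt_of_notMem (hx : x ∉ A) : loopsAt A x = {[x]} := by
  ext l
  constructor
  · rintro ⟨h1, h2, -⟩
    rcases l with _ | ⟨u, _ | ⟨v, l⟩⟩
    · simp at h1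
    · simpa using h1
    · obtain rfl : u = x := by simpa using h1
      exact absurd (h2 u (by simp)) hx
  · rintro rfl
    exact ⟨rfl, by simp, x, rfl, rfl⟩

theorem one_le_loopMass (A : Finset V) (p : V → V → ℝ) (x : V) : 1 ≤ loopMass A p x :=
  ENNReal.le_tsum (f := fun l : loopsAt A x => walkMass p l) ⟨[x], trivial_mem_loopsAt A x⟩

variable [DecidableEq V]

open Classical in
theorem tsum_walks_ne_top [Fintype V] (hpos : IsPositiveWeight A p) (hint : IsIntegrableWeight A p)
    (hx : x ∈ A) (T : Set V) :
    (∑' ω : List V, if ω ∈ walks A x T then walkMass p ω else 0) ≠ ∞ := by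
  refine ne_top_of_le_ne_top (tsum_walkMass_ne_top hpos hint hx) ?_
  rw [← (List.cons_injective (a := x)).tsum_eq]
  · refine ENNReal.tsum_le_tsum fun l => ?_
    by_cases h : x :: l ∈ walks A x T
    · rw [if_pos h, if_pos h.2.1]
    · rw [if_neg h]
      exact zero_le
  · intro ω hω
    have h : ω ∈ walks A x T := by
      by_contra h
      simp [h] at hω
    cases ω with
    | nil => simp [walks] at h
    | cons u l =>
      obtain rfl : u = x := by simpa using h.1
      exact ⟨l, rfl⟩

theorem loopMass_ne_top [Fintype V] (hpos : IsPositiveWeight A p) (hint : IsIntegrableWeight A p)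
    (hBA : B ⊆ A) (x : V) : loopMass B p x ≠ ∞ := by
  classical
  by_cases hx : x ∈ B
  · refine ne_top_of_le_ne_top (tsum_walks_ne_top hpos hint (hBA hx) {x}) ?_
    rw [loopMass, tsum_subtype]
    refine ENNReal.tsum_le_tsum fun l => ?_
    rw [Set.indicator_apply]
    split_ifs with h1 h2
    · exact le_rfl
    · exact absurd ⟨h1.1, fun v hv => hBA (h1.2.1 v hv), h1.2.2⟩ h2
    · exact zero_le
    · exact zero_le
  · rw [loopMass, loopsAt_of_notMem hx, tsum_singleton ([x] : List V) (walkMass p)]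
    simp [walkMass]

theorem green_eq_toReal [Fintype V] (hpos : IsPositiveWeight A p) (hint : IsIntegrableWeight A p)
    (hBA : B ⊆ A) (x : V) : green B p x x = (loopMass B p x).toReal := by
  rw [loopMass, ENNReal.tsum_toReal_eq (ENNReal.ne_top_of_tsum_ne_top
    (loopMass_ne_top hpos hint hBA x))]
  refine tsum_congr fun l => ?_
  obtain ⟨h1, h2⟩ := walkMass_loop (hpos.mono hBA) l.2
  rw [h2, ENNReal.toReal_ofReal h1]

theorem exists_total_rootedLoopMass [Fintype V] (hpos : IsPositiveWeight A p) (hint : IsIntegrableWeight A p)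
    (hx : x ∈ A) : ∃ Λ : ℝ≥0, ∑' l : nontrivialLoops A x, (rootedLoopMass p x l : ℝ≥0∞) = Λ := by
  suffices h : ∑' l : nontrivialLoops A x, (rootedLoopMass p x l : ℝ≥0∞) ≠ ∞ from
    ⟨_, (ENNReal.coe_toNNReal h).symm⟩
  refine ne_top_of_le_ne_top (loopMass_ne_top hpos hint subset_rfl x) (le_trans ?_
    (ENNReal.tsum_comp_le_tsum_of_injective (Set.inclusion_injective
      fun l (hl : l ∈ nontrivialLoops A x) => hl.1) fun l : loopsAt A x => walkMass p l))
  refine ENNReal.tsum_le_tsum fun l => ?_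
  rw [rootedLoopMass_eq hpos]
  refine mul_le_of_le_one_left' (ENNReal.ofReal_le_one.2 (inv_le_one_of_one_le₀ ?_))
  exact_mod_cast Nat.one_le_iff_ne_zero.2
    fun h0 => l.2.2 ((count_tail_eq_zero_iff hx l.2.1).1 h0)

theorem tsum_soupMass_concatLoops (hpos : IsPositiveWeight A p) (hx : x ∈ A) (Λ : ℝ≥0) {t : ℝ≥0}
    (ht : 0 < t) {l : List V} (hl : l ∈ loopsAt A x) :
    (∑' σ : List (nontrivialLoops A x), if concatLoops x (σ.map Subtype.val) = l then
      soupMass (rootedLoopMass p x) Λ t σ else 0) =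
    ENNReal.ofReal (Real.exp (-(Λ * t))) *
      (ENNReal.ofReal (Real.Gamma (l.tail.count x + t) /
        ((l.tail.count x).factorial * Real.Gamma t)) * walkMass p l) := by
  have h : ∀ σ : List (nontrivialLoops A x),
      (if concatLoops x (σ.map Subtype.val) = l then
        soupMass (rootedLoopMass p x) Λ t σ else 0) =
      ENNReal.ofReal (Real.exp (-(Λ * t))) * (ENNReal.ofReal (t ^ σ.length / σ.length.factorial) *
        if concatLoops x (σ.map Subtype.val) = l then
          (σ.map fun l => (rootedLoopMass p x l : ℝ≥0∞)).prod else 0) := by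
    intro σ
    split_ifs
    · rfl
    · simp
  simp only [h]
  rw [ENNReal.tsum_mul_left, ENNReal.tsum_list_length, ← tsum_logCoeff (NNReal.coe_pos.2 ht),
    ← ENNReal.tsum_mul_right]
  congr 1
  refine tsum_congr fun j => ?_
  rw [mul_assoc, ← tsum_concatLoops_length hpos hx j hl, ← ENNReal.tsum_mul_left]
  refine tsum_congr fun σ => ?_
  by_cases hσ : σ.length = j <;> simp [hσ]

/-- At `t = 1` every Gamma quotient is `k!/k! = 1`, so total probability one reads `exp(-Λ) · G =
1`. -/
theorem ofReal_exp_eq_loopMass (hpos : IsPositiveWeight A p) (hx : x ∈ A) {Λ : ℝ≥0}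
    (hΛ : ∑' l : nontrivialLoops A x, (rootedLoopMass p x l : ℝ≥0∞) = Λ) :
    ENNReal.ofReal (Real.exp Λ) = loopMass A p x := by
  have h1 := tsum_soupMass hΛ 1
  have h2 : ∀ σ : List (nontrivialLoops A x), soupMass (rootedLoopMass p x) Λ 1 σ =
      ∑' l : loopsAt A x, if concatLoops x (σ.map Subtype.val) = (l : List V) then
        soupMass (rootedLoopMass p x) Λ 1 σ else 0 := by
    intro σ
    rw [tsum_eq_single ⟨_, concatLoops_mem_loopsAt hx σ⟩]
    · simp
    · intro l hl
      rw [if_neg fun h => hl (Subtype.ext h.symm)]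
  rw [tsum_congr h2, ENNReal.tsum_comm,
    tsum_congr fun l : loopsAt A x => tsum_soupMass_concatLoops hpos hx Λ zero_lt_one l.2,
    ENNReal.tsum_mul_left] at h1
  have h3 : ∀ l : loopsAt A x, ENNReal.ofReal (Real.Gamma ((l : List V).tail.count x + (1 : ℝ≥0)) /
      (((l : List V).tail.count x).factorial * Real.Gamma (1 : ℝ≥0))) * walkMass p l =
      walkMass p l := by
    intro l
    rw [NNReal.coe_one, Real.Gamma_nat_eq_factorial, Real.Gamma_one, mul_one, div_self
      (by positivity), ENNReal.ofReal_one, one_mul]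
  rw [tsum_congr h3] at h1
  change _ * loopMass A p x = 1 at h1
  have h4 : ENNReal.ofReal (Real.exp Λ) * ENNReal.ofReal (Real.exp (-(Λ * (1 : ℝ≥0)))) = 1 := by
    rw [← ENNReal.ofReal_mul (Real.exp_pos _).le, ← Real.exp_add]
    simp
  calc ENNReal.ofReal (Real.exp Λ)
      = ENNReal.ofReal (Real.exp Λ) *
        (ENNReal.ofReal (Real.exp (-(Λ * (1 : ℝ≥0)))) * loopMass A p x) := by rw [h1, mul_one]
    _ = loopMass A p x := by rw [← mul_assoc, h4, one_mul]

end LoopMass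

/-! ### The law of the growing loop -/

section GrowingLoop

variable {V : Type*} {A : Finset V} {p : V → V → ℝ} {x : V}
  {Ω : Type*} {mΩ : MeasurableSpace Ω} {P : Measure Ω}
  {N : nontrivialLoops A x → ℝ≥0 → Ω → ℕ}

theorem growingLoop_eq {t : ℝ≥0} {ω : Ω} {h : List (ℝ≥0 × nontrivialLoops A x)}
    (H : IsHistory (fun l s => N l s ω) t h) :
    growingLoop N t ω = concatLoops x ((h.map Prod.snd).map Subtype.val) := by
  have hex : ∃ e, IsHistory (fun l s => N l s ω) t e := ⟨h, H⟩
  rw [growingLoop, dif_pos hex, hex.choose_spec.unique H, List.map_map]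
  rfl

theorem growingLoop_mem_loopsAt [DecidableEq V] (hx : x ∈ A) (t : ℝ≥0) (ω : Ω) :
    growingLoop N t ω ∈ loopsAt A x := by
  by_cases hex : ∃ h, IsHistory (fun l s => N l s ω) t h
  · obtain ⟨h, H⟩ := hex
    rw [growingLoop_eq H]
    exact concatLoops_mem_loopsAt hx _
  · rw [growingLoop, dif_neg hex]
    exact trivial_mem_loopsAt A x

theorem aemeasurable_growingLoop [Fintype V] [DecidableEq V] [IsProbabilityMeasure P]
    (hpos : IsPositiveWeight A p) (hint : IsIntegrableWeight A p)
    (hx : x ∈ A) (hN : IsSoup N (rootedLoopMass p x) P) (t : ℝ≥0) :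
    AEMeasurable (growingLoop N t) P := by
  obtain ⟨Λ, hΛ⟩ := exists_total_rootedLoopMass hpos hint hx
  exact (hN.map_history hΛ t (fun σ => concatLoops x (σ.map Subtype.val))
    fun ω h H => growingLoop_eq H).1

theorem map_growingLoop_singleton [Fintype V] [DecidableEq V] [IsProbabilityMeasure P]
    (hpos : IsPositiveWeight A p) (hint : IsIntegrableWeight A p)
    (hx : x ∈ A) (hN : IsSoup N (rootedLoopMass p x) P) {t : ℝ≥0} (ht : 0 < t) {l : List V}
    (hl : l ∈ loopsAt A x) :
    P.map (growingLoop N t) {l} = ENNReal.ofReal (green A p x x ^ (-(t : ℝ)) *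
      (Real.Gamma (l.tail.count x + t) / ((l.tail.count x).factorial * Real.Gamma t)) *
        walkWeight p l) := by
  obtain ⟨Λ, hΛ⟩ := exists_total_rootedLoopMass hpos hint hx
  have hG : green A p x x = Real.exp Λ := by
    rw [green_eq_toReal hpos hint subset_rfl, ← ofReal_exp_eq_loopMass hpos hx hΛ,
      ENNReal.toReal_ofReal (Real.exp_pos _).le]
  have h := (hN.map_history hΛ t (fun σ => concatLoops x (σ.map Subtype.val))
    fun ω h H => growingLoop_eq H).2 l
  have hΓ : 0 ≤ Real.Gamma (l.tail.count x + t) /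
      ((l.tail.count x).factorial * Real.Gamma t) := by positivity
  rw [hG, ← Real.exp_mul, ENNReal.ofReal_mul (mul_nonneg (Real.exp_pos _).le hΓ),
    ENNReal.ofReal_mul (Real.exp_pos _).le, ← (walkMass_loop hpos hl).2, mul_neg, mul_assoc,
    ← tsum_soupMass_concatLoops hpos hx Λ ht hl, h]
  exact tsum_congr fun σ => by congr

theorem map_growingLoop_one_singleton [Fintype V] [DecidableEq V] [IsProbabilityMeasure P]
    (hpos : IsPositiveWeight A p)
    (hint : IsIntegrableWeight A p) (hx : x ∈ A) (hN : IsSoup N (rootedLoopMass p x) P)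
    {l : List V} (hl : l ∈ loopsAt A x) :
    P.map (growingLoop N 1) {l} = ENNReal.ofReal (walkWeight p l / green A p x x) := by
  rw [map_growingLoop_singleton hpos hint hx hN zero_lt_one hl, NNReal.coe_one,
    Real.Gamma_nat_eq_factorial, Real.Gamma_one, mul_one, div_self (by positivity), mul_one,
    Real.rpow_neg_one, mul_comm, div_eq_mul_inv]

end GrowingLoop

/-! ### The loops erased from a walk -/

section Erasure

variable {V : Type*}

theorem List.rdropWhile_append_of_all {α : Type*} (q : α → Bool) (l r : List α)
    (h : ∀ a ∈ r, q a) : (l ++ r).rdropWhile q = l.rdropWhile q := by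
  induction r using List.reverseRecOn with
  | nil => simp
  | append_singleton r a ih =>
    rw [← List.append_assoc, List.rdropWhile_concat_pos _ _ _ (h a (by simp))]
    exact ih fun b hb => h b (List.mem_append_left _ hb)

theorem List.rtakeWhile_append_of_all {α : Type*} (q : α → Bool) (l r : List α)
    (h : ∀ a ∈ r, q a) : (l ++ r).rtakeWhile q = l.rtakeWhile q ++ r := by
  induction r using List.reverseRecOn with
  | nil => simp
  | append_singleton r a ih =>
    rw [← List.append_assoc, List.rtakeWhile_concat_pos _ _ _ (h a (by simp)),
      ih fun b hb => h b (List.mem_append_left _ hb), List.append_assoc]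

theorem mem_loopsAt_iff_exists_append {A : Finset V} {x : V} {l : List V} :
    l ∈ loopsAt A x ↔ l.head? = some x ∧ ∃ l', l = l' ++ [x] ∧ ∀ v ∈ l', v ∈ A := by
  constructor
  · rintro ⟨h1, h2, y, rfl, h3⟩
    refine ⟨h1, l.dropLast, ?_, h2⟩
    rw [List.dropLast_append_getLast?]
    exact h3
  · rintro ⟨h1, l', rfl, h2⟩
    exact ⟨h1, by simpa using h2, x, rfl, by simp⟩

theorem append_mem_walks_iff {A : Finset V} {x : V} {T : Set V} {l r : List V}
    (hl : l ∈ loopsAt A x) : l ++ r ∈ walks A x T ↔ x :: r ∈ walks A x T := by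
  obtain ⟨h1, l', rfl, h2⟩ := mem_loopsAt_iff_exists_append.1 hl
  have hd : (l' ++ [x] ++ r).dropLast = l' ++ (x :: r).dropLast := by
    rw [List.append_assoc, List.singleton_append, List.dropLast_append_of_ne_nil (by simp)]
  have hh : (l' ++ [x] ++ r).head? = some x := by
    rw [List.head?_append, h1]
    rfl
  have hg : (l' ++ [x] ++ r).getLast? = (x :: r).getLast? := by
    rw [List.append_assoc, List.singleton_append, List.getLast?_append,
      List.getLast?_cons, Option.some_or]
  simp only [walks, Set.mem_ofPred_eq, hd, hh, hg, List.mem_append]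
  constructor
  · rintro ⟨-, h3, h4⟩
    exact ⟨rfl, fun v hv => h3 v (Or.inr hv), h4⟩
  · rintro ⟨-, h3, h4⟩
    exact ⟨trivial, fun v hv => hv.elim (h2 v) (h3 v), h4⟩

theorem walkMass_loop_append (p : V → V → ℝ) {A : Finset V} {x : V} {l : List V}
    (hl : l ∈ loopsAt A x) (r : List V) :
    walkMass p (l ++ r) = walkMass p l * walkMass p (x :: r) := by
  obtain ⟨-, l', rfl, -⟩ := mem_loopsAt_iff_exists_append.1 hl
  rw [List.append_assoc, List.singleton_append, walkMass_append]

variable {A : Finset V} {p : V → V → ℝ} {x : V} {T : Set V}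

open Classical in
/-- The total weight of the walks in `walks A x T` with a given property. -/
noncomputable def walkSum (A : Finset V) (p : V → V → ℝ) (x : V) (T : Set V)
    (Q : List V → Prop) : ℝ≥0∞ :=
  ∑' ω : List V, if ω ∈ walks A x T ∧ Q ω then walkMass p ω else 0

theorem walkSum_congr {Q Q' : List V → Prop} (h : ∀ ω ∈ walks A x T, Q ω ↔ Q' ω) :
    walkSum A p x T Q = walkSum A p x T Q' := by
  classical
  refine tsum_congr fun ω => ?_
  by_cases hω : ω ∈ walks A x T
  · simp only [hω, true_and, h ω hω]
  · simp [hω]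

theorem walkMeasure_apply (hpos : IsPositiveWeight A p) (S : Set (List V)) :
    walkMeasure A p x T S = walkSum A p x T (· ∈ S) := by
  classical
  rw [walkMeasure, Measure.sum_apply _ (MeasurableSet.of_discrete), walkSum]
  have h : ∀ ω : walks A x T, (ENNReal.ofReal (walkWeight p ω) • Measure.dirac (ω : List V)) S =
      (fun ω => if ω ∈ S then walkMass p ω else 0) (ω : List V) := by
    intro ω
    rw [Measure.smul_apply, Measure.dirac_apply, ← (walkMass_loop hpos ω.2).2, Set.indicator_apply]
    simp
  rw [tsum_congr h, tsum_subtype (walks A x T) fun ω => if ω ∈ S then walkMass p ω else 0]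
  refine tsum_congr fun ω => ?_
  rw [Set.indicator_apply, ← ite_and]

variable [DecidableEq V]

theorem firstErasedLoop_append_afterLastVisit (ω : List V) :
    firstErasedLoop ω ++ afterLastVisit ω = ω := by
  cases ω with
  | nil => rfl
  | cons v r =>
    rw [firstErasedLoop, afterLastVisit, List.cons_append, List.rdropWhile_append_rtakeWhile]

/-- Appending is inverse to erasing: walks from `x` correspond to pairs of a loop at `x` and a
remainder avoiding `x`. -/
theorem erase_loop_append {l r : List V} (hl : l ∈ loopsAt A x)
    (hr : x ∉ r) : firstErasedLoop (l ++ r) = l ∧ afterLastVisit (l ++ r) = r := by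
  obtain ⟨h1, l', rfl, -⟩ := mem_loopsAt_iff_exists_append.1 hl
  have hall : ∀ a ∈ r, decide (a ≠ x) = true := fun a ha => by
    simpa using ne_of_mem_of_not_mem ha hr
  cases l' with
  | nil =>
    have h2 := List.rdropWhile_append_of_all _ [] r hall
    have h3 := List.rtakeWhile_append_of_all _ [] r hall
    simp only [List.nil_append, List.singleton_append, firstErasedLoop, afterLastVisit] at h2 h3 ⊢
    rw [h2, h3]
    simp
  | cons u l' =>
    obtain rfl : u = x := by simpa using h1
    have h2 := List.rdropWhile_append_of_all _ (l' ++ [u]) r hall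
    have h3 := List.rtakeWhile_append_of_all _ (l' ++ [u]) r hall
    simp only [List.cons_append, firstErasedLoop, afterLastVisit]
    rw [h2, h3, List.rdropWhile_concat_neg _ _ _ (by simp),
      List.rtakeWhile_concat_neg _ _ _ (by simp)]
    simp

theorem notMem_afterLastVisit {r : List V} : x ∉ afterLastVisit (x :: r) := by
  intro h
  simpa using List.mem_rtakeWhile_imp h

theorem firstErasedLoop_mem_loopsAt {ω : List V}
    (hω : ω ∈ walks A x T) : firstErasedLoop ω ∈ loopsAt A x ∧ x ∉ afterLastVisit ω := by
  cases ω with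
  | nil => simp [walks] at hω
  | cons u r =>
    obtain rfl : u = x := by simpa using hω.1
    refine ⟨mem_loopsAt_iff_exists_append.2 ⟨rfl, ?_⟩, notMem_afterLastVisit⟩
    have happ := firstErasedLoop_append_afterLastVisit (u :: r)
    have hdrop : ∀ l' a, firstErasedLoop (u :: r) = l' ++ [a] → ∀ v ∈ l', v ∈ A := by
      intro l' a h v hv
      refine hω.2.1 v ?_
      rw [← happ, h, List.append_assoc, List.dropLast_append_of_ne_nil (by simp)]
      exact List.mem_append_left _ hv
    rcases List.eq_nil_or_concat (r.rdropWhile fun v => v ≠ u) with h | ⟨s, a, h⟩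
    · exact ⟨[], by rw [firstErasedLoop, h]; rfl, by simp⟩
    · have ha : a = u := by
        have := List.rdropWhile_last_not (fun v => decide (v ≠ u)) r (by rw [h]; simp)
        simp only [h] at this
        simpa using this
      subst ha
      have h' : firstErasedLoop (a :: r) = (a :: s) ++ [a] := by
        rw [firstErasedLoop, h]
        simp
      exact ⟨a :: s, h', hdrop _ _ h'⟩

/-! ### The law of the erased loops -/

open Classical in
/-- The total weight of the walks `x :: r` in `walks A x T` that do not return to `x`, with a
property of `r`. -/
noncomputable def escapeSum (A : Finset V) (p : V → V → ℝ) (x : V) (T : Set V)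
    (Q : List V → Prop) : ℝ≥0∞ :=
  ∑' r : List V, if x ∉ r ∧ x :: r ∈ walks A x T ∧ Q r then walkMass p (x :: r) else 0

/-- The second factor does not involve `l`: this is the independence of the first erased loop from
what follows. -/
theorem walkSum_firstErasedLoop {l : List V} (hl : l ∈ loopsAt A x) (Q : List V → Prop) :
    walkSum A p x T (fun ω => firstErasedLoop ω = l ∧ Q (afterLastVisit ω)) =
      walkMass p l * escapeSum A p x T Q := by
  classical
  rw [walkSum, escapeSum, ← ENNReal.tsum_mul_left, ← (List.append_right_injective l).tsum_eq]
  · refine tsum_congr fun r => ?_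
    by_cases hr : x ∈ r
    · rw [if_neg, if_neg (fun h => h.1 hr), mul_zero]
      rintro ⟨hω, h, -⟩
      have h1 := firstErasedLoop_append_afterLastVisit (l ++ r)
      rw [h] at h1
      have h2 := (firstErasedLoop_mem_loopsAt hω).2
      rw [List.append_cancel_left h1] at h2
      exact h2 hr
    · obtain ⟨h1, h2⟩ := erase_loop_append hl hr
      simp only [h1, h2, append_mem_walks_iff hl, walkMass_loop_append p hl, hr, not_false_eq_true,
        true_and]
      split_ifs <;> simp
  · intro ω hω
    have h : firstErasedLoop ω = l := by
      by_contra h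
      simp [h] at hω
    exact ⟨afterLastVisit ω, by
      rw [← h]
      exact firstErasedLoop_append_afterLastVisit ω⟩

theorem walkSum_afterLastVisit (Q : List V → Prop) :
    walkSum A p x T (fun ω => Q (afterLastVisit ω)) = loopMass A p x * escapeSum A p x T Q := by
  classical
  rw [loopMass, ← ENNReal.tsum_mul_right,
    ← tsum_congr fun l : loopsAt A x => walkSum_firstErasedLoop l.2 Q]
  simp only [walkSum]
  rw [ENNReal.tsum_comm]
  refine tsum_congr fun ω => ?_
  by_cases hω : ω ∈ walks A x T
  · rw [tsum_eq_single ⟨_, (firstErasedLoop_mem_loopsAt hω).1⟩]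
    · simp
    · intro l hl
      rw [if_neg]
      rintro ⟨-, h, -⟩
      exact hl (Subtype.ext h.symm)
  · simp [hω]

/-- The domain Markov property: after its last visit to `x` the walk lives in `A \ {x}`. The target
loses `x` as well, since the walk may not end there. -/
theorem cons_mem_walks_iff {y : V} {r : List V} :
    (x ∉ y :: r ∧ x :: y :: r ∈ walks A x T) ↔
      x ∈ A ∧ y :: r ∈ walks (A \ {x}) y (T \ {x}) := by
  have hmem : x ∈ y :: r ↔ x ∈ (y :: r).dropLast ∨ (y :: r).getLast? = some x := by
    conv_lhs => rw [← List.dropLast_append_getLast (List.cons_ne_nil y r), List.mem_append,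
      List.mem_singleton]
    rw [List.getLast?_eq_some_getLast (List.cons_ne_nil y r), Option.some_inj, eq_comm (a := x)]
  rw [hmem]
  simp only [walks, Set.mem_ofPred_eq, List.head?_cons, true_and, List.dropLast_cons_cons,
    List.mem_cons, forall_eq_or_imp, List.getLast?_cons_cons, Finset.mem_sdiff,
    Finset.mem_singleton, Set.mem_sdiff, Set.mem_singleton_iff]
  constructor
  · rintro ⟨h1, ⟨hx, h2⟩, z, hz, h3⟩
    refine ⟨hx, fun v hv => ⟨h2 v hv, ?_⟩, z, ⟨hz, ?_⟩, h3⟩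
    · rintro rfl
      exact h1 (Or.inl hv)
    · rintro rfl
      exact h1 (Or.inr h3)
  · rintro ⟨hx, h2, z, ⟨hz, hzx⟩, h3⟩
    refine ⟨?_, ⟨hx, fun v hv => (h2 v hv).1⟩, z, hz, h3⟩
    rintro (h | h)
    · exact (h2 x h).2 rfl
    · rw [h3, Option.some_inj] at h
      exact hzx h

open Classical in
theorem escapeSum_eq {y : V} {Q : List V → Prop} (hQ : ∀ r, Q r → r.head? = some y) :
    escapeSum A p x T Q =
      if x ∈ A then ENNReal.ofReal (p x y) * walkSum (A \ {x}) p y (T \ {x}) Q else 0 := by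
  have h : ∀ r : List V, (if x ∉ r ∧ x :: r ∈ walks A x T ∧ Q r then walkMass p (x :: r) else 0) =
      if x ∈ A then ENNReal.ofReal (p x y) *
        (if r ∈ walks (A \ {x}) y (T \ {x}) ∧ Q r then walkMass p r else 0) else 0 := by
    intro r
    by_cases hr : Q r
    · cases r with
      | nil => simpa using hQ _ hr
      | cons u r =>
        obtain rfl : u = y := by simpa using hQ _ hr
        simp only [hr, and_true, cons_mem_walks_iff, walkMass]
        by_cases hx : x ∈ A <;> simp [hx]
    · simp [hr]
  rw [escapeSum, tsum_congr h]
  split_ifs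
  · rw [ENNReal.tsum_mul_left, walkSum]
  · simp

theorem loopErasure_eq_cons_iff {ω : List V} (hω : ω ∈ walks A x T) (z : V) (η : List V) :
    loopErasure ω = z :: η ↔ x = z ∧ loopErasure (afterLastVisit ω) = η := by
  cases ω with
  | nil => simp [walks] at hω
  | cons u r =>
    obtain rfl : u = x := by simpa using hω.1
    rw [loopErasure, List.cons.injEq]

theorem erasedLoops_eq_cons_iff {ω : List V} (hω : ω ∈ walks A x T) (l : List V)
    (ls : List (List V)) : erasedLoops ω = l :: ls ↔
      firstErasedLoop ω = l ∧ erasedLoops (afterLastVisit ω) = ls := by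
  cases ω with
  | nil => simp [walks] at hω
  | cons u r => rw [erasedLoops, List.cons.injEq]

theorem loopErasure_eq_nil_iff {ω : List V} : loopErasure ω = [] ↔ ω = [] := by
  cases ω <;> simp [loopErasure]

theorem erasedLoops_eq_nil_iff {ω : List V} : erasedLoops ω = [] ↔ ω = [] := by
  cases ω <;> simp [erasedLoops]

theorem head?_of_loopErasure_eq {ω : List V} {y : V} {η : List V} (h : loopErasure ω = y :: η) :
    ω.head? = some y := by
  cases ω with
  | nil => simp [loopErasure] at h
  | cons u r =>
    rw [loopErasure, List.cons.injEq] at h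
    simp [h.1]

/-- The conditional law, cleared of denominators so that no finiteness is needed. `A`, `x` and `T`
all change in the induction, as each vertex of `η` is removed from the domain and the target. -/
theorem walkSum_erasedLoops (η : List V) (ls : Fin η.length → List V)
    (hls : ∀ j : Fin η.length, ls j ∈ loopsAt (A \ (η.take j).toFinset) (η.get j)) :
    walkSum A p x T (fun ω => loopErasure ω = η ∧ erasedLoops ω = List.ofFn ls) *
        ∏ j : Fin η.length, loopMass (A \ (η.take j).toFinset) p (η.get j) =
      walkSum A p x T (fun ω => loopErasure ω = η) * ∏ j, walkMass p (ls j) := by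
  induction η generalizing A x T with
  | nil =>
    have : walkSum A p x T (fun ω => loopErasure ω = [] ∧ erasedLoops ω = List.ofFn ls) =
        walkSum A p x T (fun ω => loopErasure ω = []) :=
      walkSum_congr fun ω _ => by simp [loopErasure_eq_nil_iff, erasedLoops_eq_nil_iff]
    rw [this]
    simp
  | cons z η ih =>
    by_cases hxz : x = z
    · subst hxz
      have hl₀ : ls 0 ∈ loopsAt A x := by simpa using hls 0
      have hA : ∀ j : Fin η.length, A \ ((x :: η).take (j.succ : Fin (η.length + 1))).toFinset =
          (A \ {x}) \ (η.take j).toFinset := by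
        intro j
        ext v
        simp [and_assoc]
      have hls' : ∀ j : Fin η.length,
          ls j.succ ∈ loopsAt ((A \ {x}) \ (η.take j).toFinset) (η.get j) := by
        intro j
        rw [← hA]
        exact hls j.succ
      have h1 : walkSum A p x T (fun ω => loopErasure ω = x :: η) =
          loopMass A p x * escapeSum A p x T fun r => loopErasure r = η := by
        rw [← walkSum_afterLastVisit]
        exact walkSum_congr fun ω hω => by simp [loopErasure_eq_cons_iff hω]
      have h2 : walkSum A p x T
          (fun ω => loopErasure ω = x :: η ∧ erasedLoops ω = List.ofFn ls) =
          walkMass p (ls 0) * escapeSum A p x T fun r =>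
            loopErasure r = η ∧ erasedLoops r = List.ofFn fun j : Fin η.length => ls j.succ := by
        rw [← walkSum_firstErasedLoop hl₀]
        refine walkSum_congr fun ω hω => ?_
        have : List.ofFn ls = ls 0 :: List.ofFn fun j : Fin η.length => ls j.succ :=
          List.ofFn_succ
        rw [this, loopErasure_eq_cons_iff hω, erasedLoops_eq_cons_iff hω]
        tauto
      have h3 : escapeSum A p x T (fun r =>
            loopErasure r = η ∧ erasedLoops r = List.ofFn fun j : Fin η.length => ls j.succ) *
          ∏ j : Fin η.length, loopMass ((A \ {x}) \ (η.take j).toFinset) p (η.get j) =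
          escapeSum A p x T (fun r => loopErasure r = η) *
            ∏ j : Fin η.length, walkMass p (ls j.succ) := by
        -- If `η` ends here there is no edge to split off and the remainder of the walk is empty.
        cases η with
        | nil =>
          have : (fun r : List V => loopErasure r = [] ∧ erasedLoops r =
              List.ofFn fun j : Fin ([] : List V).length => ls j.succ) =
              fun r => loopErasure r = [] := by
            funext r
            simp [loopErasure_eq_nil_iff, erasedLoops_eq_nil_iff]
          rw [this]
          simp
        | cons y η =>
          rw [escapeSum_eq fun r hr => head?_of_loopErasure_eq hr.1,
            escapeSum_eq fun r hr => head?_of_loopErasure_eq hr]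
          split_ifs
          · rw [mul_assoc, mul_assoc, ih (fun j => ls j.succ) hls']
          · simp
      have h4 : ∏ j : Fin (x :: η).length, loopMass (A \ ((x :: η).take j).toFinset) p
          ((x :: η).get j) = loopMass A p x *
            ∏ j : Fin η.length, loopMass ((A \ {x}) \ (η.take j).toFinset) p (η.get j) := by
        refine (Fin.prod_univ_succ (n := η.length) _).trans ?_
        simp only [hA]
        congr 1
        simp
      have h5 : ∏ j, walkMass p (ls j) =
          walkMass p (ls 0) * ∏ j : Fin η.length, walkMass p (ls j.succ) :=
        Fin.prod_univ_succ (n := η.length) _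
      rw [h1, h2, h4, h5]
      calc _ = walkMass p (ls 0) * loopMass A p x * (escapeSum A p x T (fun r =>
            loopErasure r = η ∧ erasedLoops r = List.ofFn fun j : Fin η.length => ls j.succ) *
          ∏ j : Fin η.length, loopMass ((A \ {x}) \ (η.take j).toFinset) p (η.get j)) := by ring
        _ = _ := by
          rw [h3]
          ring
    · have : ∀ Q : List V → Prop, walkSum A p x T (fun ω => loopErasure ω = z :: η ∧ Q ω) = 0 := by
        intro Q
        rw [walkSum, ENNReal.tsum_eq_zero]
        intro ω
        rw [if_neg]
        rintro ⟨hω, h, -⟩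
        exact hxz ((loopErasure_eq_cons_iff hω z η).1 h).1
      have h0 : walkSum A p x T (fun ω => loopErasure ω = z :: η) = 0 := by
        simpa using this fun _ => True
      rw [this, h0, zero_mul, zero_mul]

end Erasure

theorem map_growingLoop_one_eq {V : Type*} [Fintype V] [DecidableEq V] {A : Finset V}
    {p : V → V → ℝ} (hpos : IsPositiveWeight A p) (hint : IsIntegrableWeight A p) {x : V}
    (hx : x ∈ A) {Ω : Type*} {mΩ : MeasurableSpace Ω} {P : Measure Ω} [IsProbabilityMeasure P]
    {N : nontrivialLoops A x → ℝ≥0 → Ω → ℕ} (hN : IsSoup N (rootedLoopMass p x) P) {T : Set V}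
    (hT : walkMeasure A p x T Set.univ ≠ 0) :
    P.map (growingLoop N 1) = (cond (walkMeasure A p x T) Set.univ).map firstErasedLoop := by
  have hae := aemeasurable_growingLoop hpos hint hx hN 1
  have htot : walkMeasure A p x T Set.univ = loopMass A p x * escapeSum A p x T fun _ => True := by
    rw [walkMeasure_apply hpos, ← walkSum_afterLastVisit]
    rfl
  have hG0 : loopMass A p x ≠ 0 := (zero_lt_one.trans_le (one_le_loopMass A p x)).ne'
  have hG := loopMass_ne_top hpos hint subset_rfl x
  have htop : walkMeasure A p x T Set.univ ≠ ∞ := by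
    classical
    rw [walkMeasure_apply hpos]
    refine ne_top_of_le_ne_top (tsum_walks_ne_top hpos hint hx T) (le_of_eq ?_)
    exact tsum_congr fun ω => by simp
  refine Measure.ext_of_singleton fun l => ?_
  rw [Measure.map_apply (f := firstErasedLoop) .of_discrete .of_discrete, cond_apply .of_discrete, Set.univ_inter,
    walkMeasure_apply hpos (firstErasedLoop ⁻¹' {l})]
  by_cases hl : l ∈ loopsAt A x
  · have h1 : walkSum A p x T (· ∈ firstErasedLoop ⁻¹' {l}) =
        walkMass p l * escapeSum A p x T fun _ => True := by
      rw [← walkSum_firstErasedLoop hl]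
      exact walkSum_congr fun ω _ => by simp
    have hgreen : 0 < green A p x x := by
      rw [green_eq_toReal hpos hint subset_rfl]
      exact ENNReal.toReal_pos hG0 hG
    rw [h1, map_growingLoop_one_singleton hpos hint hx hN hl, ENNReal.ofReal_div_of_pos hgreen,
      green_eq_toReal hpos hint subset_rfl, ENNReal.ofReal_toReal hG, ← (walkMass_loop hpos hl).2,
      htot]
    rw [htot] at hT htop
    -- All dependence on `T` sits in the escape factor, which is positive and finite and cancels.
    have hE0 : (escapeSum A p x T fun _ => True) ≠ 0 := right_ne_zero_of_mul hT
    have hE : (escapeSum A p x T fun _ => True) ≠ ∞ := fun h =>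
      htop (by rw [h, ENNReal.mul_top hG0])
    rw [← ENNReal.div_eq_inv_mul, ENNReal.mul_div_mul_right _ _ hE0 hE]
  · have h1 : walkSum A p x T (· ∈ firstErasedLoop ⁻¹' {l}) = 0 := by
      rw [walkSum, ENNReal.tsum_eq_zero]
      intro ω
      rw [if_neg]
      rintro ⟨hω, rfl⟩
      exact hl (firstErasedLoop_mem_loopsAt hω).1
    rw [h1, mul_zero, Measure.map_apply_of_aemeasurable hae .of_discrete]
    have : growingLoop N 1 ⁻¹' {l} = ∅ := by
      ext ω
      simp only [Set.mem_preimage, Set.mem_singleton_iff, Set.mem_empty_iff_false, iff_false]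
      rintro rfl
      exact hl (growingLoop_mem_loopsAt hx 1 ω)
    rw [this, measure_empty]

/-- The product form expresses both the conditional independence and the individual laws. -/
theorem cond_erasedLoops {V : Type*} [Fintype V] [DecidableEq V] {A : Finset V} {p : V → V → ℝ}
    (hpos : IsPositiveWeight A p) (hint : IsIntegrableWeight A p) {x : V} (hx : x ∈ A) {T : Set V}
    {η : List V} (hη : walkMeasure A p x T {ω | loopErasure ω = η} ≠ 0)
    {ls : Fin η.length → List V}
    (hls : ∀ j : Fin η.length, ls j ∈ loopsAt (A \ (η.take j).toFinset) (η.get j)) :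
    (cond (walkMeasure A p x T) {ω | loopErasure ω = η}).real {ω | erasedLoops ω = List.ofFn ls} =
      ∏ j, walkWeight p (ls j) / green (A \ (η.take j).toFinset) p (η.get j) (η.get j) := by
  have hsub : ∀ j : Fin η.length, A \ (η.take j).toFinset ⊆ A := fun j => Finset.sdiff_subset
  have h := congrArg ENNReal.toReal (walkSum_erasedLoops (p := p) (A := A) (x := x) (T := T) η ls hls)
  have htop : walkMeasure A p x T {ω | loopErasure ω = η} ≠ ∞ := by
    classical
    rw [walkMeasure_apply hpos]
    refine ne_top_of_le_ne_top (tsum_walks_ne_top hpos hint hx T) (ENNReal.tsum_le_tsum fun ω => ?_)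
    by_cases hω : ω ∈ walks A x T
    · rw [if_pos hω]
      split_ifs
      · exact le_rfl
      · exact zero_le
    · rw [if_neg fun h => hω h.1]
      exact zero_le
  rw [measureReal_def, cond_apply .of_discrete, ENNReal.toReal_mul, ENNReal.toReal_inv]
  have h1 : walkMeasure A p x T ({ω | loopErasure ω = η} ∩ {ω | erasedLoops ω = List.ofFn ls}) =
      walkSum A p x T fun ω => loopErasure ω = η ∧ erasedLoops ω = List.ofFn ls :=
    walkMeasure_apply hpos _
  have h2 : walkMeasure A p x T {ω | loopErasure ω = η} =
      walkSum A p x T fun ω => loopErasure ω = η := walkMeasure_apply hpos _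
  have hη' := ENNReal.toReal_ne_zero.2 ⟨hη, htop⟩
  rw [ENNReal.toReal_mul, ENNReal.toReal_mul, ENNReal.toReal_prod, ENNReal.toReal_prod,
    ← h1, ← h2] at h
  have hgreen : ∀ j : Fin η.length, green (A \ (η.take j).toFinset) p (η.get j) (η.get j) =
      (loopMass (A \ (η.take j).toFinset) p (η.get j)).toReal :=
    fun j => green_eq_toReal hpos hint (hsub j) _
  have hmass : ∀ j : Fin η.length, walkWeight p (ls j) = (walkMass p (ls j)).toReal := fun j => by
    obtain ⟨h3, h4⟩ := walkMass_loop (hpos.mono (hsub j)) (hls j)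
    rw [h4, ENNReal.toReal_ofReal h3]
  simp only [hgreen, hmass, Finset.prod_div_distrib]
  have hne : ∏ j : Fin η.length, (loopMass (A \ (η.take j).toFinset) p (η.get j)).toReal ≠ 0 :=
    Finset.prod_ne_zero_iff.2 fun j _ => ENNReal.toReal_ne_zero.2
      ⟨(zero_lt_one.trans_le (one_le_loopMass _ _ _)).ne', loopMass_ne_top hpos hint (hsub j) _⟩
  rw [eq_div_iff hne, mul_assoc, h, inv_mul_cancel_left₀ hη']

theorem mainTheorem9 {V : Type*} [Fintype V] [DecidableEq V] (A : Finset V) (p : V → V → ℝ)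
    (hpos : IsPositiveWeight A p) (hint : IsIntegrableWeight A p) (x : V) (hx : x ∈ A)
    {Ω : Type*} [MeasurableSpace Ω] (P : Measure Ω) [IsProbabilityMeasure P]
    (N : nontrivialLoops A x → ℝ≥0 → Ω → ℕ) (hN : IsSoup N (rootedLoopMass p x) P) :
    -- almost surely, the loops that have appeared by time `t` can be listed in order of appearance
    (∀ t : ℝ≥0, ∀ᵐ ω ∂P, ∃ h, IsHistory (fun l s => N l s ω) t h) ∧
    -- the growing loop is a random loop rooted at `x`
    (∀ t : ℝ≥0, AEMeasurable (growingLoop N t) P ∧ ∀ᵐ ω ∂P, growingLoop N t ω ∈ loopsAt A x) ∧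
    -- its law at time `t`
    (∀ t : ℝ≥0, 0 < t → ∀ k : ℕ, ∀ l ∈ loopsOfOrder A x k,
      (P.map (growingLoop N t)).real {l} =
        green A p x x ^ (-(t : ℝ)) *
          (Real.Gamma (k + t) / (k.factorial * Real.Gamma t)) * walkWeight p l) ∧
    -- its law at time `1`
    (∀ l ∈ loopsAt A x,
      (P.map (growingLoop N 1)).real {l} = walkWeight p l / green A p x x) ∧
    -- the law at time `1` is the law of the loop erased at `x`, and given the loop-erasure `η`, the
    -- loops erased at its vertices are independent with laws of this form
    (∀ T : Set V, walkMeasure A p x T Set.univ ≠ 0 →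
      P.map (growingLoop N 1) =
        (cond (walkMeasure A p x T) Set.univ).map firstErasedLoop ∧
      ∀ η : List V, walkMeasure A p x T {ω | loopErasure ω = η} ≠ 0 →
        ∀ ls : Fin η.length → List V,
          (∀ j : Fin η.length, ls j ∈ loopsAt (A \ (η.take j).toFinset) (η.get j)) →
          (cond (walkMeasure A p x T) {ω | loopErasure ω = η}).real
              {ω | erasedLoops ω = List.ofFn ls} =
            ∏ j, walkWeight p (ls j) /
              green (A \ (η.take j).toFinset) p (η.get j) (η.get j)) := by
  obtain ⟨Λ, hΛ⟩ := exists_total_rootedLoopMass hpos hint hx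
  have hgreen : 0 ≤ green A p x x := by
    rw [green_eq_toReal hpos hint subset_rfl]
    exact ENNReal.toReal_nonneg
  refine ⟨fun t => hN.ae_exists_isHistory hΛ t, fun t => ⟨aemeasurable_growingLoop hpos hint hx hN t,
    Filter.Eventually.of_forall fun ω => growingLoop_mem_loopsAt hx t ω⟩, ?_, ?_, ?_⟩
  · intro t ht k l hl
    obtain ⟨hl, hk⟩ := loopsOfOrder_subset hx k l hl
    have ht' : (0 : ℝ) < t := ht
    rw [measureReal_def, map_growingLoop_singleton hpos hint hx hN ht hl, hk,
      ENNReal.toReal_ofReal]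
    exact mul_nonneg (by positivity) (walkMass_loop hpos hl).1
  · intro l hl
    rw [measureReal_def, map_growingLoop_one_singleton hpos hint hx hN hl, ENNReal.toReal_ofReal]
    exact div_nonneg (walkMass_loop hpos hl).1 hgreen
  · intro T hT
    exact ⟨map_growingLoop_one_eq hpos hint hx hN hT,
      fun η hη ls hls => cond_erasedLoops hpos hint hx hη hls⟩
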